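/- Let $\Gamma$ be a countably infinite connected graph with weights $\mu_{x,y}=\mu_{y,x}>0$ on its edges $x\sim y$ (and $\mu_{x,y}=0$ otherwise) such that $\mu(x)=\sum_{y\sim x}\mu_{x,y}<\infty$ for every vertex $x$; put $\mu(A)=\sum_{y\in A}\mu(y)$. Let $(X_k)$ be the random walk with transition probabilities $P(x,y)=\mu_{x,y}/\mu(x)$, and $\Delta=P-I$. With $d$ the graph distance, put $B(x,R)=\{y:d(x,y)<R\}$, $V(x,R)=\mu(B(x,R))$ and $v(x,r,R)=V(x,R)-V(x,r)$. For $A\subset\Gamma$ let $T_A=\min\{k\ge 0:X_k\notin A\}$, and let $E(x,R)=\mathbb E(T_{B(x,R)}\mid X_0=x)$. Let $P^A_k$ be the $k$-step transition probabilities of the walk killed on leaving $A$, and let $g^A(x,y)=\frac1{\mu(y)}\sum_{k\ge0}P^A_k(x,y)$ be the local Green kernel. For disjoint $A,B\subset \Gamma$ let $\rho(A,B)=\big(\inf\{\sum_x(-\Delta f)(x)f(x)\mu(x)\}\big)^{-1}$, where the infimum is over the finitely supported $f:\Gamma\to\mathbb R$ with $f=1$ on $A$ and $f=0$ on $B$,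 and let $\rho(x,r,R)=\rho(B(x,r),\Gamma\setminus B(x,R))$. Assume - $(p_0)$: there is $p_0>0$ with $P(x,y)\ge p_0$ whenever $x\sim y$; - $(VD)$: there is $D_V>0$ with $V(x,2R)\le D_V V(x,R)$ for all $x\in\Gamma$ and all real $R>0$. Then the following are equivalent. 1. $(g)$: there are $C,c>0$ such that for all $x\in\Gamma$ and all real $R>0$ $$\max_{y\notin B(x,R)} g^{B(x,2R)}(x,y)\le C\,\frac{E(x,2R)}{V(x,R)},\qquad \min_{y\in B(x,R)} g^{B(x,2R)}(x,y)\ge c\,\frac{E(x,2R)}{V(x,R)}.$$ 2. Both of the following hold. - $(H)$ (elliptic Harnack inequality): there is $H>1$ such that for all $x\in\Gamma$, all real $R>0$ and every $u$ that is non-negative on $B(x,2R)$ and its neighbours and harmonic in $B(x,2R)$ (that is, $\sum_yP(z,y)u(y)=u(z)$ for $z\in B(x,2R)$), $\max_{B(x,R)}u\le H\min_{B(x,R)}u$. - $(ER)$ (Einstein relation): there is $C>0$ such that for all $x\in\Gamma$ and all real $R>1/2$ $$C^{-1}\rho(x,R,2R)\,v(x,R,2R)\le E(x,2R)\le C\,\rho(x,R,2R)\,v(x,R,2R).$$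 -/

import Mathlib

open MeasureTheory ProbabilityTheory
open scoped NNReal ENNReal

/-- A connected weighted graph `(Γ, μ)` on the vertex set `V`: symmetric weights `μ_{x,y}` which are
positive exactly on the edges, and with finite total weight at each vertex. -/
structure WeightedGraph (V : Type*) where
  graph : SimpleGraph V
  connected : graph.Connected
  weight : V → V → ℝ≥0
  weight_symm : ∀ x y, weight x y = weight y x
  weight_pos_iff : ∀ x y, 0 < weight x y ↔ graph.Adj x y
  weight_summable : ∀ x, Summable (weight x)

namespace WeightedGraph

noncomputable section

variable {V : Type*} (W : WeightedGraph V)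

/-- The measure of a vertex, `μ(x) = ∑_y μ_{x,y}`. -/
def vertexMeasure (x : V) : ℝ≥0 := ∑' y, W.weight x y

/-- The measure of a set, `μ(A) = ∑_{y ∈ A} μ(y)`. -/
def setMeasure (A : Set V) : ℝ≥0∞ := ∑' y : A, (W.vertexMeasure y : ℝ≥0∞)

/-- The transition probabilities `P(x,y) = μ_{x,y} / μ(x)`. -/
def transition (x y : V) : ℝ≥0 := W.weight x y / W.vertexMeasure x

/-- The open ball `B(x,R) = {y : d(x,y) < R}` of the shortest path distance. -/
def ball (x : V) (R : ℝ) : Set V := {y | (W.graph.dist x y : ℝ) < R}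

/-- `V(x,R) = μ(B(x,R))`. -/
def vol (x : V) (R : ℝ) : ℝ≥0∞ := W.setMeasure (W.ball x R)

/-- `v(x,r,R) = V(x,R) - V(x,r)`, the volume of an annulus (for `r ≤ R`). -/
def annulusVol (x : V) (r R : ℝ) : ℝ≥0∞ := W.vol x R - W.vol x r

/-- Condition `(p₀)`. -/
def ControlledWeights : Prop :=
  ∃ p₀ : ℝ≥0, 0 < p₀ ∧ ∀ x y, W.graph.Adj x y → p₀ ≤ W.transition x y

/-- Condition `(VD)`, volume doubling. -/
def VolumeDoubling : Prop :=
  ∃ D : ℝ≥0, 0 < D ∧ ∀ (x : V) (R : ℝ), 0 < R → W.vol x (2 * R) ≤ D * W.vol x R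

/-! ### The Laplace operator, harmonic functions, the elliptic Harnack inequality -/

/-- The Markov operator `Pf(x) = ∑_y P(x,y) f(y)`. -/
def markovOp (f : V → ℝ) (x : V) : ℝ := ∑' y, (W.transition x y : ℝ) * f y

/-- The Laplace operator `Δ = P - I`. -/
def laplacian (f : V → ℝ) (x : V) : ℝ := W.markovOp f x - f x

/-- The inner product `(f,g) = ∑_x f(x) g(x) μ(x)` (used when one of the functions has finite
support). -/
def innerMu (f g : V → ℝ) : ℝ := ∑' x, f x * g x * (W.vertexMeasure x : ℝ)

/-- The closure of `A`: the points of `A` and their neighbours. -/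
def closure (A : Set V) : Set V := A ∪ {y | ∃ x ∈ A, W.graph.Adj x y}

/-- `u` is harmonic on `A`: `Pu(x) = u(x)` for `x ∈ A`, where the series `Pu(x)` converges. Only the
values of `u` on the closure of `A` matter. -/
def HarmonicOn (u : V → ℝ) (A : Set V) : Prop :=
  ∀ x ∈ A, HasSum (fun y => (W.transition x y : ℝ) * u y) (u x)

/-- Condition `(H)`, the elliptic Harnack inequality:
`max_{B(x,R)} u ≤ H min_{B(x,R)} u` for every `u` that is harmonic in `B(x,2R)` and non-negative
where it is defined, that is, on the closure of `B(x,2R)`. -/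
def EllipticHarnack : Prop :=
  ∃ H : ℝ, 1 < H ∧ ∀ (x : V) (R : ℝ), 0 < R → ∀ u : V → ℝ,
    W.HarmonicOn u (W.ball x (2 * R)) → (∀ y ∈ W.closure (W.ball x (2 * R)), 0 ≤ u y) →
    ∀ y ∈ W.ball x R, ∀ z ∈ W.ball x R, u y ≤ H * u z

/-! ### The resistance -/

/-- The resistance `ρ(A,B)`, the inverse of the infimum of the energies `(-Δf, f)` over the finitely
supported `f` with `f = 1` on `A` and `f = 0` on `B`. -/
def resistance (A B : Set V) : ℝ≥0∞ :=
  (⨅ (f : V →₀ ℝ) (_ : (∀ x ∈ A, f x = 1) ∧ ∀ x ∈ B, f x = 0),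
    ENNReal.ofReal (W.innerMu (fun x => - W.laplacian f x) f))⁻¹

/-- `ρ(x,r,R) = ρ(B(x,r), Γ - B(x,R))`. -/
def annulusResistance (x : V) (r R : ℝ) : ℝ≥0∞ :=
  W.resistance (W.ball x r) (W.ball x R)ᶜ

/-! ### The local Green kernel -/

open Classical in
/-- The transition probabilities `P^A` of the walk killed on leaving `A`. -/
def killedTransition (A : Set V) (x y : V) : ℝ≥0∞ :=
  if x ∈ A ∧ y ∈ A then (W.transition x y : ℝ≥0∞) else 0

open Classical in
/-- The iterates `P_k^A`; `P_0^A` is the identity on `A`. -/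
def killedIterate (A : Set V) : ℕ → V → V → ℝ≥0∞
  | 0, x, y => if x ∈ A ∧ x = y then 1 else 0
  | k + 1, x, y => ∑' z, W.killedTransition A x z * killedIterate A k z y

/-- The local Green function `G^A(x,y) = ∑_k P_k^A(x,y)`. -/
def greenFunction (A : Set V) (x y : V) : ℝ≥0∞ := ∑' k, W.killedIterate A k x y

/-- The local Green kernel `g^A(x,y) = G^A(x,y) / μ(y)`. -/
def greenKernel (A : Set V) (x y : V) : ℝ≥0∞ := W.greenFunction A x y / W.vertexMeasure y

/-- The exit time `T_A = min {k : X_k ∉ A}` of a path (`∞` if the path stays in `A`). -/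
def exitTime (A : Set V) (ω : ℕ → V) : ℝ≥0∞ := ⨅ (k : ℕ) (_ : ω k ∉ A), (k : ℝ≥0∞)

/-! ### The random walk and the mean exit time -/

theorem vertexMeasure_pos [Infinite V] (x : V) : 0 < W.vertexMeasure x := by
  obtain ⟨y, hy⟩ := W.connected.preconnected.exists_adj_of_nontrivial x
  exact NNReal.tsum_pos (W.weight_summable x) y ((W.weight_pos_iff x y).2 hy)

theorem tsum_transition [Infinite V] (x : V) :
    ∑' y, (W.transition x y : ℝ≥0∞) = 1 := by
  have h0 : W.vertexMeasure x ≠ 0 := (W.vertexMeasure_pos x).ne'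
  have h1 : HasSum (fun y => W.transition x y) 1 := by
    have := (W.weight_summable x).hasSum.div_const (W.vertexMeasure x)
    rwa [← vertexMeasure, div_self h0] at this
  exact (ENNReal.hasSum_coe.2 h1).tsum_eq

/-- The law `P(x, ·)` of one step of the walk from `x`. -/
def stepLaw [Infinite V] (x : V) : PMF V :=
  ⟨fun y => (W.transition x y : ℝ≥0∞), W.tsum_transition x ▸ ENNReal.summable.hasSum⟩

variable [Infinite V] [Countable V] [MeasurableSpace V] [DiscreteMeasurableSpace V]

/-- The one-step kernel, as a kernel from the history `(X_0, …, X_n)` to `X_{n+1}`; it depends on the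
last position `X_n` only. -/
def stepKernel (n : ℕ) : Kernel (Finset.Iic n → V) V :=
  (Kernel.ofFunOfCountable fun x => (W.stepLaw x).toMeasure).comap
    (fun h => h ⟨n, Finset.mem_Iic.2 le_rfl⟩) (measurable_pi_apply _)

instance (n : ℕ) : IsMarkovKernel (W.stepKernel n) :=
  ⟨fun h => PMF.toMeasure.isProbabilityMeasure (W.stepLaw (h ⟨n, Finset.mem_Iic.2 le_rfl⟩))⟩

/-- The law on path space of the random walk `(X_k)` with `X_0 = z`. -/
def walkLaw (z : V) : Measure (ℕ → V) :=
  Kernel.traj (X := fun _ => V) W.stepKernel 0 (fun _ => z)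

/-- `E_z(A) = 𝔼(T_A | X_0 = z)`. -/
def meanExitFrom (z : V) (A : Set V) : ℝ≥0∞ := ∫⁻ ω, exitTime A ω ∂(W.walkLaw z)

/-- `E(x,R) = E_x(B(x,R))`. -/
def meanExit (x : V) (R : ℝ) : ℝ≥0∞ := W.meanExitFrom x (W.ball x R)

/-- Condition `(ER)`, the Einstein relation `E(x,2R) ≃ ρ(x,R,2R) v(x,R,2R)`, for `R > 1/2`; for
`R ≤ 1/2` the balls `B(x,R)` and `B(x,2R)` are both `{x}`, and the annulus is empty. -/
def EinsteinRelation : Prop :=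
  ∃ C : ℝ≥0, 0 < C ∧ ∀ (x : V) (R : ℝ), 1 / 2 < R →
    W.meanExit x (2 * R) ≤ C * (W.annulusResistance x R (2 * R) * W.annulusVol x R (2 * R)) ∧
    W.annulusResistance x R (2 * R) * W.annulusVol x R (2 * R) ≤ C * W.meanExit x (2 * R)

/-- Condition `(g)`, the two-sided bounds
`max_{y ∉ B(x,R)} g^{B(x,2R)}(x,y) ≤ C E(x,2R) / V(x,R)` and
`min_{y ∈ B(x,R)} g^{B(x,2R)}(x,y) ≥ c E(x,2R) / V(x,R)`. -/
def GreenKernelBounds : Prop :=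
  ∃ C c : ℝ≥0, 0 < C ∧ 0 < c ∧ ∀ (x : V) (R : ℝ), 0 < R →
    (⨆ y ∈ (W.ball x R)ᶜ, W.greenKernel (W.ball x (2 * R)) x y)
      ≤ C * (W.meanExit x (2 * R) / W.vol x R) ∧
    c * (W.meanExit x (2 * R) / W.vol x R)
      ≤ ⨅ y ∈ W.ball x R, W.greenKernel (W.ball x (2 * R)) x y

end

end WeightedGraph

namespace WeightedGraph

noncomputable section

variable {V : Type*} (W : WeightedGraph V)

/-! ### The mean exit time as a sum of the Green function -/

/-! Write F(x,R) = E(x,2R)/V(x,R), called `gscale` below. Condition $(p_0)$ makes the graph locally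
finite, so balls are finite and everything reduces to potential theory on finite sets: the minimum
principle (`nonneg_of_lap_nonpos`), Green's identity (`sum_mul_lap_comm`), and the facts that the
Green kernel g of a finite set is symmetric and has Laplacian minus a unit charge at its pole. The
mean exit time is the integral of g against μ.

Two estimates relate g to the resistance ρ(x,R,2R). If g ≥ κ on B(x,R), then min(g,κ)/κ is a test
function of energy at most 1/κ, so ρ ≥ κ (`le_annulusResistance`). If g ≤ M off B(x,R), then ρ ≤ M/p
(`annulusResistance_le`).

(H) and (ER) imply (g). By Harnack chains and the symmetry of g, the values of g on a sphere of
radius about R are comparable to one number t (`Harnack.gb_sphere`), and the minimum principle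
carries this inwards and outwards. Integrating over B(x,R) gives t ≲ F; the resistance estimate and
(ER) give F ≲ t.

(g) implies (ER). The two estimates give ρ ≈ F. Under doubling the annulus has volume comparable to
V(x,R), and E = F·V(x,R).

(g) implies (H). This is the long direction. Comparison with g shows that a lower bound of a
positive superharmonic function on a ball persists on the doubled ball, hence along geodesics
(`GreenBounds.chain`). An exit argument between two distant balls then shows that F(y,2r) ≲ F(y,r/8)
(`GreenBounds.exists_gscale_le`). So the kernels of B(x,2r) with poles a, b near x are comparable at
points z away from x (`GreenBounds.exists_gr_le`). A function that is positive and harmonic in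
B(x,2r), set to zero outside, is the Green potential of positive charges lying away from x.
Comparing its values at a and b charge by charge gives Harnack for a small ratio of radii, and
chaining gives (H). -/

theorem killedIterate_succ_right (A : Set V) (k : ℕ) (x y : V) :
    W.killedIterate A (k + 1) x y = ∑' z, W.killedIterate A k x z * W.killedTransition A z y := by
  classical
  induction k generalizing x with
  | zero =>
    have h1 : ∀ z, W.killedTransition A x z * W.killedIterate A 0 z y
        = if z = y then W.killedTransition A x y else 0 := by
      intro z
      by_cases hz : z = y
      · subst hz
        by_cases hA : z ∈ A <;> simp [killedIterate, killedTransition, hA]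
      · simp [killedIterate, hz]
    have h2 : ∀ z, W.killedIterate A 0 x z * W.killedTransition A z y
        = if z = x then W.killedTransition A x y else 0 := by
      intro z
      by_cases hz : z = x
      · subst hz
        by_cases hA : z ∈ A <;> simp [killedIterate, killedTransition, hA]
      · simp [killedIterate, hz, Ne.symm hz]
    rw [killedIterate, tsum_congr h1, tsum_congr h2, tsum_ite_eq, tsum_ite_eq]
  | succ k ih =>
    rw [killedIterate]
    simp_rw [ih]
    conv_rhs => rw [show (fun z => W.killedIterate A (k + 1) x z * W.killedTransition A z y)
      = fun z => ∑' w, W.killedTransition A x w * W.killedIterate A k w z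
        * W.killedTransition A z y from funext fun z => by
          rw [killedIterate, ENNReal.tsum_mul_right]]
    rw [ENNReal.tsum_comm]
    refine tsum_congr fun w => ?_
    rw [← ENNReal.tsum_mul_left]
    exact tsum_congr fun z => (mul_assoc _ _ _).symm

/-- The walk is counted at each time k up to which it has not left; the value ∞ is included. By
Tonelli, `meanExitFrom_eq_tsum` then needs only the probabilities of staying up to time k. -/
theorem exitTime_eq_tsum (A : Set V) (ω : ℕ → V) :
    exitTime A ω = ∑' k, {ω : ℕ → V | ∀ i ≤ k, ω i ∈ A}.indicator 1 ω := by
  classical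
  by_cases h : ∃ k, ω k ∉ A
  · have hk := Nat.find_spec h
    have hmin := fun i (hi : i < Nat.find h) => not_not.1 (Nat.find_min h hi)
    set n := Nat.find h
    have h1 : exitTime A ω = n := by
      refine le_antisymm (iInf₂_le n hk) (le_iInf₂ fun i hi => ?_)
      exact_mod_cast not_lt.1 fun hlt => hi (hmin i hlt)
    have h2 : ∀ k ∉ Finset.range n,
        {ω : ℕ → V | ∀ i ≤ k, ω i ∈ A}.indicator (1 : (ℕ → V) → ℝ≥0∞) ω = 0 := by
      intro k hkn
      rw [Finset.mem_range, not_lt] at hkn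
      exact Set.indicator_of_notMem (s := {ω : ℕ → V | ∀ i ≤ k, ω i ∈ A})
        (fun hc => hk (hc n hkn)) _
    rw [h1, tsum_eq_sum h2]
    have h3 : ∀ k ∈ Finset.range n,
        {ω : ℕ → V | ∀ i ≤ k, ω i ∈ A}.indicator (1 : (ℕ → V) → ℝ≥0∞) ω = 1 := by
      intro k hkn
      rw [Finset.mem_range] at hkn
      exact Set.indicator_of_mem (s := {ω : ℕ → V | ∀ i ≤ k, ω i ∈ A})
        (fun i hi => hmin i (by omega)) _
    rw [Finset.sum_congr rfl h3]
    simp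
  · push Not at h
    have h1 : exitTime A ω = ⊤ := by simp [exitTime, h]
    have h2 : ∀ k, {ω : ℕ → V | ∀ i ≤ k, ω i ∈ A}.indicator (1 : (ℕ → V) → ℝ≥0∞) ω = 1 :=
      fun k => Set.indicator_of_mem (s := {ω : ℕ → V | ∀ i ≤ k, ω i ∈ A}) (fun i _ => h i) _
    rw [h1, tsum_congr h2, ENNReal.tsum_const_eq_top_of_ne_zero one_ne_zero]

theorem measurableSet_stay [MeasurableSpace V] [DiscreteMeasurableSpace V] (A : Set V) (k : ℕ) :
    MeasurableSet {ω : ℕ → V | ∀ i ≤ k, ω i ∈ A} := by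
  have : {ω : ℕ → V | ∀ i ≤ k, ω i ∈ A} = ⋂ i, ⋂ (_ : i ≤ k), (fun ω : ℕ → V => ω i) ⁻¹' A := by
    ext; simp
  rw [this]
  exact MeasurableSet.iInter fun i => MeasurableSet.iInter fun _ =>
    measurable_pi_apply i (MeasurableSet.of_discrete)

variable [Infinite V] [Countable V] [MeasurableSpace V] [DiscreteMeasurableSpace V]

instance (z : V) : IsProbabilityMeasure (W.walkLaw z) := by
  unfold walkLaw; infer_instance

theorem walkLaw_map_zero (z : V) (f : V → ℝ≥0∞) : ∫⁻ ω, f (ω 0) ∂(W.walkLaw z) = f z := by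
  have h := Kernel.traj_map_frestrictLe_apply (X := fun _ => V) (κ := W.stepKernel) 0 0
    (fun _ => z)
  have hf : Measurable (fun h : (Finset.Iic 0) → V => f (h ⟨0, Finset.mem_Iic.2 le_rfl⟩)) :=
    (Measurable.of_discrete (f := f)).comp (measurable_pi_apply _)
  have h2 := lintegral_map (μ := W.walkLaw z) hf
    (Preorder.measurable_frestrictLe (X := fun _ : ℕ => V) 0)
  rw [walkLaw, h, Kernel.partialTraj_self, Kernel.id_apply, lintegral_dirac' _ hf] at h2
  exact h2.symm

theorem lintegral_stepLaw (x : V) (f : V → ℝ≥0∞) :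
    ∫⁻ y, f y ∂(W.stepLaw x).toMeasure = ∑' y, (W.transition x y : ℝ≥0∞) * f y := by
  rw [lintegral_countable']
  refine tsum_congr fun y => ?_
  rw [PMF.toMeasure_apply_singleton _ _ (MeasurableSet.singleton y), mul_comm]
  rfl

/-- The Markov property: the joint law of the history up to time k and of the next position is the
history law composed with `stepKernel`, which sees the last position only. Killing enters because
that position is known to lie in A. -/
theorem lintegral_stay_succ (A : Set V) (k : ℕ) (z : V) (f : V → ℝ≥0∞) :
    ∫⁻ ω, {ω : ℕ → V | ∀ i ≤ k + 1, ω i ∈ A}.indicator (fun ω => f (ω (k + 1))) ω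
        ∂(W.walkLaw z)
      = ∫⁻ ω, {ω : ℕ → V | ∀ i ≤ k, ω i ∈ A}.indicator
          (fun ω => ∑' y, W.killedTransition A (ω k) y * f y) ω ∂(W.walkLaw z) := by
  classical
  set g : ((Finset.Iic k) → V) × V → ℝ≥0∞ := fun p =>
    {h : (Finset.Iic k) → V | ∀ i, h i ∈ A}.indicator 1 p.1 * A.indicator f p.2 with hg
  have hS : MeasurableSet {h : (Finset.Iic k) → V | ∀ i, h i ∈ A} := by
    have : {h : (Finset.Iic k) → V | ∀ i, h i ∈ A} = ⋂ i, (fun h => h i) ⁻¹' A := by ext; simp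
    rw [this]
    exact MeasurableSet.iInter fun i => measurable_pi_apply i (MeasurableSet.of_discrete)
  have hgm : Measurable g := by
    refine Measurable.mul ?_ ?_
    · exact (measurable_one.indicator hS).comp measurable_fst
    · exact (Measurable.of_discrete (f := A.indicator f)).comp measurable_snd
  have h := Kernel.partialTraj_compProd_eq_map_traj (X := fun _ => V) (κ := W.stepKernel)
    (Nat.zero_le k) (x₀ := fun _ => z)
  have hm : Measurable (fun x : ℕ → V => (Preorder.frestrictLe (π := fun _ => V) k x, x (k + 1))) := by
    fun_prop
  have h1 : ∫⁻ ω, g (Preorder.frestrictLe (π := fun _ => V) k ω, ω (k + 1)) ∂(W.walkLaw z)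
      = ∫⁻ h, ∫⁻ y, g (h, y) ∂(W.stepKernel k h)
        ∂(Kernel.partialTraj (X := fun _ => V) W.stepKernel 0 k (fun _ => z)) := by
    rw [walkLaw, ← lintegral_map hgm hm, ← h, Measure.lintegral_compProd hgm]
  have h3 : ∀ h : (Finset.Iic k) → V, ∫⁻ y, g (h, y) ∂(W.stepKernel k h)
      = {h : (Finset.Iic k) → V | ∀ i, h i ∈ A}.indicator
        (fun h => ∑' y, W.killedTransition A (h ⟨k, Finset.mem_Iic.2 le_rfl⟩) y * f y) h := by
    intro h
    have : W.stepKernel k h = (W.stepLaw (h ⟨k, Finset.mem_Iic.2 le_rfl⟩)).toMeasure := rfl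
    rw [this, lintegral_stepLaw]
    by_cases hh : h ∈ {h : (Finset.Iic k) → V | ∀ i, h i ∈ A}
    · rw [Set.indicator_of_mem hh]
      refine tsum_congr fun y => ?_
      have hk := hh ⟨k, Finset.mem_Iic.2 le_rfl⟩
      simp only [hg]
      rw [Set.indicator_of_mem hh]
      by_cases hy : y ∈ A <;> simp [killedTransition, hk, hy]
    · simp only [hg]
      rw [Set.indicator_of_notMem hh, Set.indicator_of_notMem hh]
      simp
  have hF : Measurable (fun h : (Finset.Iic k) → V =>
      {h : (Finset.Iic k) → V | ∀ i, h i ∈ A}.indicator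
        (fun h => ∑' y, W.killedTransition A (h ⟨k, Finset.mem_Iic.2 le_rfl⟩) y * f y) h) := by
    refine Measurable.indicator ?_ hS
    exact (Measurable.of_discrete (f := fun x => ∑' y, W.killedTransition A x y * f y)).comp
      (measurable_pi_apply _)
  rw [lintegral_congr h3, ← Kernel.traj_map_frestrictLe_apply, lintegral_map hF
    (Preorder.measurable_frestrictLe _)] at h1
  refine Eq.trans (lintegral_congr fun ω => ?_) (h1.trans (lintegral_congr fun ω => ?_))
  · by_cases hω : ∀ i ≤ k + 1, ω i ∈ A
    · have a1 : ∀ i : Finset.Iic k, Preorder.frestrictLe (π := fun _ => V) k ω i ∈ A :=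
        fun i => hω i ((Finset.mem_Iic.1 i.2).trans (Nat.le_succ k))
      rw [Set.indicator_of_mem (show ω ∈ {ω : ℕ → V | ∀ i ≤ k + 1, ω i ∈ A} from hω)]
      simp only [hg]
      rw [Set.indicator_of_mem (show _ ∈ {h : (Finset.Iic k) → V | ∀ i, h i ∈ A} from a1),
        Set.indicator_of_mem (hω _ le_rfl)]
      simp
    · rw [Set.indicator_of_notMem (show ω ∉ {ω : ℕ → V | ∀ i ≤ k + 1, ω i ∈ A} from hω)]
      by_cases hl : ω (k + 1) ∈ A
      · have : Preorder.frestrictLe (π := fun _ => V) k ω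
            ∉ {h : (Finset.Iic k) → V | ∀ i, h i ∈ A} := by
          intro hc
          refine hω fun i hi => ?_
          rcases Nat.lt_or_ge k i with h | h
          · rwa [show i = k + 1 by omega]
          · exact hc ⟨i, Finset.mem_Iic.2 h⟩
        simp only [hg]
        rw [Set.indicator_of_notMem this, zero_mul]
      · simp only [hg]
        rw [Set.indicator_of_notMem hl, mul_zero]
  · by_cases hω : ∀ i ≤ k, ω i ∈ A
    · have a1 : ∀ i : Finset.Iic k, Preorder.frestrictLe (π := fun _ => V) k ω i ∈ A :=
        fun i => hω i (Finset.mem_Iic.1 i.2)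
      rw [Set.indicator_of_mem (show _ ∈ {h : (Finset.Iic k) → V | ∀ i, h i ∈ A} from a1),
        Set.indicator_of_mem (show ω ∈ {ω : ℕ → V | ∀ i ≤ k, ω i ∈ A} from hω)]
      rfl
    · rw [Set.indicator_of_notMem (show ω ∉ {ω : ℕ → V | ∀ i ≤ k, ω i ∈ A} from hω),
        Set.indicator_of_notMem]
      exact fun hc => hω fun i hi => hc ⟨i, Finset.mem_Iic.2 hi⟩

theorem lintegral_stay (A : Set V) (k : ℕ) (z : V) (f : V → ℝ≥0∞) :
    ∫⁻ ω, {ω : ℕ → V | ∀ i ≤ k, ω i ∈ A}.indicator (fun ω => f (ω k)) ω ∂(W.walkLaw z)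
      = ∑' y, W.killedIterate A k z y * f y := by
  classical
  induction k generalizing f with
  | zero =>
    have h1 : ∀ ω : ℕ → V, {ω : ℕ → V | ∀ i ≤ 0, ω i ∈ A}.indicator (fun ω => f (ω 0)) ω
        = A.indicator f (ω 0) := by
      intro ω
      by_cases h : ω 0 ∈ A <;> simp [Set.indicator, h]
    rw [lintegral_congr h1, walkLaw_map_zero]
    have h2 : ∀ y, W.killedIterate A 0 z y * f y = if y = z then A.indicator f z else 0 := by
      intro y
      by_cases hy : y = z
      · subst hy; by_cases h : y ∈ A <;> simp [killedIterate, h]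
      · simp [killedIterate, hy, Ne.symm hy]
    rw [tsum_congr h2, tsum_ite_eq]
  | succ k ih =>
    rw [lintegral_stay_succ, ih (fun x => ∑' y, W.killedTransition A x y * f y)]
    simp_rw [← ENNReal.tsum_mul_left]
    rw [ENNReal.tsum_comm]
    refine tsum_congr fun y => ?_
    rw [killedIterate_succ_right, ← ENNReal.tsum_mul_right]
    exact tsum_congr fun x => (mul_assoc _ _ _).symm

theorem meanExitFrom_eq_tsum (A : Set V) (z : V) :
    W.meanExitFrom z A = ∑' y, W.greenFunction A z y := by
  unfold meanExitFrom greenFunction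
  simp_rw [exitTime_eq_tsum]
  rw [lintegral_tsum fun k => (measurable_one.indicator (measurableSet_stay A k)).aemeasurable,
    ENNReal.tsum_comm]
  refine tsum_congr fun k => ?_
  have := W.lintegral_stay A k z 1
  simp only [Pi.one_apply, mul_one] at this
  exact this

end

end WeightedGraph

namespace WeightedGraph

noncomputable section

open scoped Classical

variable {V : Type*} (W : WeightedGraph V)

/-! ### Potential theory on locally finite weighted graphs -/

/-- Every vertex has finitely many neighbours. -/
class LocFinite : Prop where
  finite_adj : ∀ x, {y | W.graph.Adj x y}.Finite

/-- The weights as real numbers. -/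
def cond (x y : V) : ℝ := W.weight x y

/-- The measure of a vertex as a real number. -/
def mass (x : V) : ℝ := W.vertexMeasure x

/-- The finite set of neighbours of a vertex. -/
def nbrs [W.LocFinite] (x : V) : Finset V := (LocFinite.finite_adj (W := W) x).toFinset

/-- The Laplace operator multiplied by the measure of the vertex. -/
def lap [W.LocFinite] (u : V → ℝ) (x : V) : ℝ := ∑ y ∈ W.nbrs x, W.cond x y * (u y - u x)

theorem cond_nonneg (x y : V) : 0 ≤ W.cond x y := NNReal.coe_nonneg _

theorem cond_symm (x y : V) : W.cond x y = W.cond y x := by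
  rw [cond, cond, W.weight_symm]

theorem cond_pos {x y : V} (h : W.graph.Adj x y) : 0 < W.cond x y :=
  NNReal.coe_pos.2 ((W.weight_pos_iff x y).2 h)

theorem cond_eq_zero {x y : V} (h : ¬ W.graph.Adj x y) : W.cond x y = 0 :=
  le_antisymm (not_lt.1 fun h0 => h ((W.weight_pos_iff x y).1 (NNReal.coe_pos.1 h0)))
    (W.cond_nonneg x y)

theorem mass_nonneg (x : V) : 0 ≤ W.mass x := NNReal.coe_nonneg _

theorem mass_pos [Infinite V] (x : V) : 0 < W.mass x := NNReal.coe_pos.2 (W.vertexMeasure_pos x)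

theorem sum_cond_le_mass (S : Finset V) (x : V) : ∑ y ∈ S, W.cond x y ≤ W.mass x := by
  have := (W.weight_summable x).sum_le_tsum S (fun _ _ => zero_le)
  simp only [cond, mass, vertexMeasure]
  exact_mod_cast this

/-- A set of vertices closed under taking neighbours is everything. -/
theorem forall_of_adj_closed {p : V → Prop} {x : V} (hx : p x)
    (h : ∀ a b, W.graph.Adj a b → p a → p b) (y : V) : p y := by
  obtain ⟨w⟩ := W.connected.preconnected x y
  induction w with
  | nil => exact hx
  | cons hadj _ ih => exact ih (h _ _ hadj hx)

theorem tsum_killedTransition_mul_ofReal {A : Finset V} {x : V} (hx : x ∈ A) {f : V → ℝ}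
    (hf : ∀ z, 0 ≤ f z) :
    ∑' z, W.killedTransition (A : Set V) x z * ENNReal.ofReal (f z)
      = ENNReal.ofReal (∑ z ∈ A, W.cond x z / W.mass x * f z) := by
  rw [tsum_eq_sum (s := A) (fun z hz => by simp [killedTransition, hz]),
    ENNReal.ofReal_sum_of_nonneg fun z _ =>
      mul_nonneg (div_nonneg (W.cond_nonneg _ _) (W.mass_nonneg _)) (hf z)]
  refine Finset.sum_congr rfl fun z hz => ?_
  rw [ENNReal.ofReal_mul (div_nonneg (W.cond_nonneg _ _) (W.mass_nonneg _))]
  congr 1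
  have : W.cond x z / W.mass x = ((W.transition x z : ℝ≥0) : ℝ) := by
    simp [cond, mass, transition]
  rw [this, ENNReal.ofReal_coe_nnreal]
  simp [killedTransition, hx, hz]

theorem killedIterate_zero (A : Finset V) (x y : V) :
    W.killedIterate (A : Set V) 0 x y = ENNReal.ofReal (if x ∈ A ∧ x = y then 1 else 0) := by
  by_cases h : x ∈ A ∧ x = y
  · rw [if_pos h]
    have : x ∈ (A : Set V) ∧ x = y := by simpa using h
    rw [killedIterate, if_pos this, ENNReal.ofReal_one]
  · rw [if_neg h]
    have : ¬ (x ∈ (A : Set V) ∧ x = y) := by simpa using h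
    rw [killedIterate, if_neg this, ENNReal.ofReal_zero]

theorem greenFunction_eq (A : Set V) (x y : V) :
    W.greenFunction A x y = W.killedIterate A 0 x y
      + ∑' z, W.killedTransition A x z * W.greenFunction A z y := by
  unfold greenFunction
  rw [tsum_eq_zero_add' ENNReal.summable]
  congr 1
  simp_rw [← ENNReal.tsum_mul_left]
  rw [ENNReal.tsum_comm]
  rfl

theorem greenFunction_eq_zero_of_notMem_left {A : Set V} {x : V} (hx : x ∉ A) (y : V) :
    W.greenFunction A x y = 0 := by
  rw [greenFunction_eq]
  simp [killedIterate, killedTransition, hx]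

theorem greenFunction_eq_zero_of_notMem_right {A : Set V} {y : V} (hy : y ∉ A) (x : V) :
    W.greenFunction A x y = 0 := by
  have : ∀ k x, W.killedIterate A k x y = 0 := by
    intro k
    induction k with
    | zero =>
      intro x
      have : ¬ (x ∈ A ∧ x = y) := fun h => hy (h.2 ▸ h.1)
      rw [killedIterate, if_neg this]
    | succ k ih => intro x; rw [killedIterate]; simp [ih]
  simp [greenFunction, this]

/-- The local Green kernel of a finite set, as a real number. -/
def gr (A : Finset V) (x y : V) : ℝ := (W.greenKernel (A : Set V) x y).toReal

theorem gr_eq (A : Finset V) (x y : V) :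
    W.gr A x y = (W.greenFunction (A : Set V) x y).toReal / W.mass y := by
  rw [gr, greenKernel, ENNReal.toReal_div]; rfl

theorem gr_nonneg (A : Finset V) (x y : V) : 0 ≤ W.gr A x y := ENNReal.toReal_nonneg

theorem gr_left_eq_zero {A : Finset V} {x : V} (hx : x ∉ A) (y : V) : W.gr A x y = 0 := by
  rw [gr_eq, W.greenFunction_eq_zero_of_notMem_left (by simpa using hx)]; simp

theorem gr_right_eq_zero {A : Finset V} (x : V) {y : V} (hy : y ∉ A) : W.gr A x y = 0 := by
  rw [gr_eq, W.greenFunction_eq_zero_of_notMem_right (by simpa using hy)]; simp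

variable [W.LocFinite]

theorem mem_nbrs {x y : V} : y ∈ W.nbrs x ↔ W.graph.Adj x y := by simp [nbrs]

theorem sum_nbrs_cond (x : V) : ∑ y ∈ W.nbrs x, W.cond x y = W.mass x := by
  have h : ∀ y ∉ W.nbrs x, W.weight x y = 0 := fun y hy => by
    have := W.cond_eq_zero (fun h => hy (W.mem_nbrs.2 h))
    exact NNReal.coe_eq_zero.1 this
  rw [mass, vertexMeasure, tsum_eq_sum h]
  push_cast
  rfl

theorem lap_eq (u : V → ℝ) (x : V) :
    W.lap u x = ∑ y ∈ W.nbrs x, W.cond x y * u y - W.mass x * u x := by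
  rw [lap, ← W.sum_nbrs_cond, Finset.sum_mul, ← Finset.sum_sub_distrib]
  exact Finset.sum_congr rfl fun y _ => by ring

theorem lap_eq_sum_of_support {S : Finset V} {u : V → ℝ} (hu : ∀ y ∉ S, u y = 0) (x : V) :
    W.lap u x = ∑ y ∈ S, W.cond x y * u y - W.mass x * u x := by
  rw [lap_eq]
  congr 1
  have h1 : ∑ y ∈ W.nbrs x, W.cond x y * u y = ∑ y ∈ W.nbrs x ∪ S, W.cond x y * u y :=
    Finset.sum_subset Finset.subset_union_left fun y _ hy => by
      rw [W.cond_eq_zero (fun h => hy (W.mem_nbrs.2 h)), zero_mul]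
  have h2 : ∑ y ∈ S, W.cond x y * u y = ∑ y ∈ W.nbrs x ∪ S, W.cond x y * u y :=
    Finset.sum_subset Finset.subset_union_right fun y _ hy => by rw [hu y hy, mul_zero]
  rw [h1, h2]

theorem lap_sub (u v : V → ℝ) (x : V) :
    W.lap (fun y => u y - v y) x = W.lap u x - W.lap v x := by
  simp only [lap, ← Finset.sum_sub_distrib]
  exact Finset.sum_congr rfl fun y _ => by ring

theorem lap_add (u v : V → ℝ) (x : V) :
    W.lap (fun y => u y + v y) x = W.lap u x + W.lap v x := by
  simp only [lap, ← Finset.sum_add_distrib]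
  exact Finset.sum_congr rfl fun y _ => by ring

theorem lap_const_mul (a : ℝ) (u : V → ℝ) (x : V) :
    W.lap (fun y => a * u y) x = a * W.lap u x := by
  simp only [lap, Finset.mul_sum]
  exact Finset.sum_congr rfl fun y _ => by ring

theorem lap_const (a : ℝ) (x : V) : W.lap (fun _ => a) x = 0 := by simp [lap]

theorem lap_sum {ι : Type*} (S : Finset ι) (u : ι → V → ℝ) (x : V) :
    W.lap (fun y => ∑ i ∈ S, u i y) x = ∑ i ∈ S, W.lap (u i) x := by
  simp only [lap]
  rw [Finset.sum_comm]
  refine Finset.sum_congr rfl fun y _ => ?_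
  rw [← Finset.sum_sub_distrib, Finset.mul_sum]

theorem lap_congr {u v : V → ℝ} {x : V} (hx : u x = v x)
    (h : ∀ y, W.graph.Adj x y → u y = v y) : W.lap u x = W.lap v x := by
  rw [lap, lap]
  exact Finset.sum_congr rfl fun y hy => by rw [hx, h y (W.mem_nbrs.1 hy)]

theorem lap_nonpos_of_max {u : V → ℝ} {x : V} (h : ∀ y, W.graph.Adj x y → u y ≤ u x) :
    W.lap u x ≤ 0 :=
  Finset.sum_nonpos fun y hy => mul_nonpos_of_nonneg_of_nonpos (W.cond_nonneg x y)
    (sub_nonpos.2 (h y (W.mem_nbrs.1 hy)))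

theorem lap_le_of_le {u v : V → ℝ} {x : V} (hx : u x = v x)
    (h : ∀ y, W.graph.Adj x y → u y ≤ v y) : W.lap u x ≤ W.lap v x :=
  Finset.sum_le_sum fun y hy => mul_le_mul_of_nonneg_left
    (by linarith [h y (W.mem_nbrs.1 hy)]) (W.cond_nonneg x y)

/-- The minimum principle on finite sets. -/
theorem nonneg_of_lap_nonpos [Infinite V] {A : Finset V} {u : V → ℝ}
    (hsup : ∀ x ∈ A, W.lap u x ≤ 0)
    (hb : ∀ x ∈ A, ∀ y, W.graph.Adj x y → y ∉ A → 0 ≤ u y) : ∀ x ∈ A, 0 ≤ u x := by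
  by_contra hcon
  push Not at hcon
  obtain ⟨x1, hx1, hneg⟩ := hcon
  obtain ⟨x0, hx0, hmin⟩ := A.exists_min_image u ⟨x1, hx1⟩
  have h0 : u x0 < 0 := (hmin x1 hx1).trans_lt hneg
  -- At a point with the negative minimal value, superharmonicity forces the same value on every
  -- neighbour. Neighbours off A have nonnegative values, so the minimum set spreads within A and,
  -- by connectedness, fills the infinite graph.
  have key : ∀ a b, W.graph.Adj a b → (a ∈ A ∧ u a = u x0) → (b ∈ A ∧ u b = u x0) := by
    rintro a b hab ⟨haA, hau⟩
    have hge : ∀ y, W.graph.Adj a y → u a ≤ u y := fun y hy => by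
      by_cases hyA : y ∈ A
      · rw [hau]; exact hmin y hyA
      · rw [hau]; exact h0.le.trans (hb a haA y hy hyA)
    have hz : W.lap u a = 0 := le_antisymm (hsup a haA) <|
      Finset.sum_nonneg fun y hy => mul_nonneg (W.cond_nonneg a y)
        (sub_nonneg.2 (hge y (W.mem_nbrs.1 hy)))
    have hterm := (Finset.sum_eq_zero_iff_of_nonneg fun y hy => mul_nonneg (W.cond_nonneg a y)
        (sub_nonneg.2 (hge y (W.mem_nbrs.1 hy)))).1 hz b (W.mem_nbrs.2 hab)
    have hub : u b = u x0 := by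
      rcases mul_eq_zero.1 hterm with h | h
      · exact absurd h (W.cond_pos hab).ne'
      · linarith
    refine ⟨by_contra fun hbA => ?_, hub⟩
    have := hb a haA b hab hbA
    linarith
  have hall : ∀ y, y ∈ A := fun y =>
    (W.forall_of_adj_closed (p := fun y => y ∈ A ∧ u y = u x0) ⟨hx0, rfl⟩ key y).1
  exact Infinite.not_finite (α := V) (Set.finite_univ_iff.1 (A.finite_toSet.subset fun y _ => hall y))

/-- The comparison principle on finite sets. -/
theorem le_of_lap_le [Infinite V] {A : Finset V} {u v : V → ℝ}
    (hsup : ∀ x ∈ A, W.lap v x ≤ W.lap u x)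
    (hb : ∀ x ∈ A, ∀ y, W.graph.Adj x y → y ∉ A → u y ≤ v y) : ∀ x ∈ A, u x ≤ v x := fun x hx =>
  sub_nonneg.1 (W.nonneg_of_lap_nonpos (u := fun y => v y - u y)
    (fun z hz => by rw [lap_sub]; linarith [hsup z hz])
    (fun z hz y hzy hy => sub_nonneg.2 (hb z hz y hzy hy)) x hx)

theorem sum_mul_lap_comm {S : Finset V} {f h : V → ℝ} (hf : ∀ y ∉ S, f y = 0)
    (hh : ∀ y ∉ S, h y = 0) :
    ∑ x ∈ S, f x * W.lap h x = ∑ x ∈ S, h x * W.lap f x := by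
  simp only [W.lap_eq_sum_of_support hf, W.lap_eq_sum_of_support hh, mul_sub,
    Finset.sum_sub_distrib, Finset.mul_sum]
  congr 1
  · rw [Finset.sum_comm]
    refine Finset.sum_congr rfl fun x _ => Finset.sum_congr rfl fun y _ => ?_
    rw [W.cond_symm y x]; ring
  · exact Finset.sum_congr rfl fun x _ => by ring

/-- This is positivity of the Dirichlet energy. It comes from 2 f(x) f(y) ≤ f(x)² + f(y)² and the
symmetry of the weights, since the weights from x into S add up to at most μ(x). -/
theorem sum_mul_lap_nonpos {S : Finset V} {f : V → ℝ} (hf : ∀ y ∉ S, f y = 0) :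
    ∑ x ∈ S, f x * W.lap f x ≤ 0 := by
  have h1 : ∑ x ∈ S, f x * W.lap f x
      = ∑ x ∈ S, ∑ y ∈ S, W.cond x y * (f x * f y) - ∑ x ∈ S, W.mass x * f x ^ 2 := by
    simp only [W.lap_eq_sum_of_support hf, mul_sub, Finset.sum_sub_distrib, Finset.mul_sum]
    congr 1
    · exact Finset.sum_congr rfl fun x _ => Finset.sum_congr rfl fun y _ => by ring
    · exact Finset.sum_congr rfl fun x _ => by ring
  have h2 : ∑ x ∈ S, ∑ y ∈ S, W.cond x y * (f x * f y)
      ≤ ∑ x ∈ S, ∑ y ∈ S, W.cond x y * ((f x ^ 2 + f y ^ 2) / 2) :=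
    Finset.sum_le_sum fun x _ => Finset.sum_le_sum fun y _ =>
      mul_le_mul_of_nonneg_left (by nlinarith [sq_nonneg (f x - f y)]) (W.cond_nonneg x y)
  have h3 : ∑ x ∈ S, ∑ y ∈ S, W.cond x y * ((f x ^ 2 + f y ^ 2) / 2)
      = ∑ x ∈ S, ∑ y ∈ S, W.cond x y * f x ^ 2 := by
    have h4 : ∑ x ∈ S, ∑ y ∈ S, W.cond x y * f y ^ 2 = ∑ x ∈ S, ∑ y ∈ S, W.cond x y * f x ^ 2 := by
      rw [Finset.sum_comm]
      exact Finset.sum_congr rfl fun x _ => Finset.sum_congr rfl fun y _ => by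
        rw [W.cond_symm y x]
    have h5 : ∑ x ∈ S, ∑ y ∈ S, W.cond x y * ((f x ^ 2 + f y ^ 2) / 2)
        = (∑ x ∈ S, ∑ y ∈ S, W.cond x y * f x ^ 2 + ∑ x ∈ S, ∑ y ∈ S, W.cond x y * f y ^ 2) / 2 := by
      simp only [← Finset.sum_add_distrib, Finset.sum_div]
      exact Finset.sum_congr rfl fun x _ => Finset.sum_congr rfl fun y _ => by ring
    rw [h5, h4]; ring
  have h6 : ∑ x ∈ S, ∑ y ∈ S, W.cond x y * f x ^ 2 ≤ ∑ x ∈ S, W.mass x * f x ^ 2 :=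
    Finset.sum_le_sum fun x _ => by
      rw [← Finset.sum_mul]
      exact mul_le_mul_of_nonneg_right (W.sum_cond_le_mass S x) (sq_nonneg _)
  linarith

/-- The Dirichlet problem for the Poisson equation on a finite set is solvable. -/
theorem exists_lap_eq [Infinite V] (A : Finset V) (k : V → ℝ) :
    ∃ s : V → ℝ, (∀ z ∉ A, s z = 0) ∧ ∀ x ∈ A, W.lap s x = k x := by
  let e : (A → ℝ) → V → ℝ := fun f z => if h : z ∈ A then f ⟨z, h⟩ else 0
  have e0 : ∀ f, ∀ z ∉ A, e f z = 0 := fun f z hz => by simp [e, hz]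
  let T : (A → ℝ) →ₗ[ℝ] (A → ℝ) :=
    { toFun := fun f x => W.lap (e f) x
      map_add' := fun f g => by
        ext x
        have : e (f + g) = fun z => e f z + e g z := by
          ext z; by_cases hz : z ∈ A <;> simp [e, hz]
        simp only [Pi.add_apply]
        rw [this, lap_add]
      map_smul' := fun a f => by
        ext x
        have : e (a • f) = fun z => a * e f z := by
          ext z; by_cases hz : z ∈ A <;> simp [e, hz]
        simp only [Pi.smul_apply, smul_eq_mul, RingHom.id_apply]
        rw [this, lap_const_mul] }
  -- The system is square, so uniqueness suffices; comparison with zero from both sides gives it.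
  have hinj : Function.Injective T := by
    rw [← LinearMap.ker_eq_bot, LinearMap.ker_eq_bot']
    intro f hf
    have hf' : ∀ x ∈ A, W.lap (e f) x = 0 := fun x hx => congrFun hf ⟨x, hx⟩
    have h1 := W.le_of_lap_le (A := A) (u := fun _ => 0) (v := e f)
      (fun x hx => by rw [hf' x hx, lap_const]) (fun x _ y _ hy => (e0 f y hy).ge)
    have h2 := W.le_of_lap_le (A := A) (v := fun _ => 0) (u := e f)
      (fun x hx => by rw [hf' x hx, lap_const]) (fun x _ y _ hy => (e0 f y hy).le)
    ext x
    have := le_antisymm (h2 x x.2) (h1 x x.2)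
    simpa [e] using this
  obtain ⟨f, hf⟩ := (LinearMap.injective_iff_surjective.1 hinj) fun x => k x
  exact ⟨e f, e0 f, fun x hx => congrFun hf ⟨x, hx⟩⟩

theorem sum_cond_div_mass_mul [Infinite V] {A : Finset V} {s : V → ℝ} (hs : ∀ z ∉ A, s z = 0)
    (x : V) : ∑ z ∈ A, W.cond x z / W.mass x * s z = s x + W.lap s x / W.mass x := by
  have hm := (W.mass_pos x).ne'
  rw [W.lap_eq_sum_of_support hs, sub_div, mul_div_cancel_left₀ _ hm, Finset.sum_div]
  have : ∑ z ∈ A, W.cond x z / W.mass x * s z = ∑ z ∈ A, W.cond x z * s z / W.mass x :=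
    Finset.sum_congr rfl fun z _ => by ring
  rw [this]; ring

/-- The partial sums of the series are dominated by the solution of the Poisson equation with a
charge at y. The induction on the number of terms decomposes at the first step of the walk. -/
theorem greenFunction_ne_top [Infinite V] (A : Finset V) (x y : V) :
    W.greenFunction (A : Set V) x y ≠ ⊤ := by
  obtain ⟨s, hs0, hs⟩ := W.exists_lap_eq A (fun x => if x = y then - W.mass y else 0)
  have hnn : ∀ z, 0 ≤ s z := fun z => by
    by_cases hz : z ∈ A
    · refine W.nonneg_of_lap_nonpos (A := A) (fun x hx => ?_) (fun x _ y _ hy => (hs0 y hy).ge) z hz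
      rw [hs x hx]
      split_ifs
      · linarith [W.mass_nonneg y]
      · exact le_rfl
    · exact (hs0 z hz).ge
  have key : ∀ n x, ∑ k ∈ Finset.range n, W.killedIterate (A : Set V) k x y
      ≤ ENNReal.ofReal (s x) := by
    intro n
    induction n with
    | zero => intro x; simp
    | succ n ih =>
      intro x
      by_cases hx : x ∈ A
      · rw [Finset.sum_range_succ']
        simp only [killedIterate]
        rw [← Summable.tsum_finsetSum fun _ _ => ENNReal.summable]
        simp_rw [← Finset.mul_sum]
        have h1 : ∑' z, W.killedTransition (A : Set V) x z
              * ∑ k ∈ Finset.range n, W.killedIterate (A : Set V) k z y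
            ≤ ∑' z, W.killedTransition (A : Set V) x z * ENNReal.ofReal (s z) :=
          ENNReal.tsum_le_tsum fun z => mul_le_mul_right (ih z) _
        rw [W.tsum_killedTransition_mul_ofReal hx hnn, W.sum_cond_div_mass_mul hs0, hs x hx] at h1
        refine (add_le_add_left h1 _).trans ?_
        by_cases hxy : x = y
        · subst hxy
          have hm := (W.mass_pos x).ne'
          have h2 := hnn x
          have h3 : 0 ≤ s x - 1 := by
            have := W.sum_cond_div_mass_mul hs0 x
            rw [hs x hx, if_pos rfl, neg_div, div_self hm] at this
            have h4 : 0 ≤ ∑ z ∈ A, W.cond x z / W.mass x * s z := Finset.sum_nonneg fun z _ =>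
              mul_nonneg (div_nonneg (W.cond_nonneg _ _) (W.mass_nonneg _)) (hnn z)
            linarith
          rw [if_pos rfl, neg_div, div_self hm, if_pos ⟨by simpa using hx, rfl⟩]
          rw [show s x + -1 = s x - 1 by ring]
          nth_rewrite 2 [show s x = (s x - 1) + 1 by ring]
          rw [ENNReal.ofReal_add h3 zero_le_one, ENNReal.ofReal_one]
        · have : ¬ (x ∈ (A : Set V) ∧ x = y) := fun h => hxy h.2
          rw [if_neg hxy, if_neg this]
          simp
      · refine (Finset.sum_eq_zero fun k _ => ?_).trans_le zero_le
        have h0 := W.greenFunction_eq_zero_of_notMem_left (A := (A : Set V)) (by simpa using hx) y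
        exact (ENNReal.tsum_eq_zero.1 h0) k
  have : W.greenFunction (A : Set V) x y ≤ ENNReal.ofReal (s x) := by
    unfold greenFunction
    exact ENNReal.tsum_le_of_sum_range_le fun n => key n x
  exact ne_top_of_le_ne_top ENNReal.ofReal_ne_top this

/-! ### The local Green kernel of a finite set -/

theorem greenKernel_eq_ofReal [Infinite V] (A : Finset V) (x y : V) :
    W.greenKernel (A : Set V) x y = ENNReal.ofReal (W.gr A x y) := by
  rw [gr, ENNReal.ofReal_toReal]
  exact ENNReal.div_ne_top (W.greenFunction_ne_top A x y)
    (by simpa using (W.vertexMeasure_pos y).ne')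

theorem greenFunction_eq_ofReal [Infinite V] (A : Finset V) (x y : V) :
    W.greenFunction (A : Set V) x y = ENNReal.ofReal (W.gr A x y * W.mass y) := by
  rw [gr_eq, div_mul_cancel₀ _ (W.mass_pos y).ne', ENNReal.ofReal_toReal
    (W.greenFunction_ne_top A x y)]

/-- This is the first-step recursion `greenFunction_eq`, multiplied by μ(x). Division by μ(y) in the
kernel makes the charge exactly -1. -/
theorem lap_gr_left [Infinite V] {A : Finset V} {x : V} (hx : x ∈ A) (y : V) :
    W.lap (fun z => W.gr A z y) x = if x = y then -1 else 0 := by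
  set h : V → ℝ := fun z => W.gr A z y * W.mass y with hh
  have hnn : ∀ z, 0 ≤ h z := fun z => mul_nonneg (W.gr_nonneg A z y) (W.mass_nonneg y)
  have hs0 : ∀ z ∉ A, h z = 0 := fun z hz => by simp [hh, W.gr_left_eq_zero hz]
  have key := W.greenFunction_eq (A : Set V) x y
  simp_rw [W.greenFunction_eq_ofReal] at key
  rw [W.tsum_killedTransition_mul_ofReal hx hnn, W.sum_cond_div_mass_mul hs0 x,
    W.killedIterate_zero, ← ENNReal.ofReal_add (by split_ifs <;> norm_num) ?_,
    ENNReal.ofReal_eq_ofReal_iff (hnn x)] at key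
  rotate_left
  · refine add_nonneg (by split_ifs <;> norm_num) ?_
    rw [← W.sum_cond_div_mass_mul hs0 x]
    exact Finset.sum_nonneg fun z _ =>
      mul_nonneg (div_nonneg (W.cond_nonneg _ _) (W.mass_nonneg _)) (hnn z)
  · rw [← W.sum_cond_div_mass_mul hs0 x]
    exact Finset.sum_nonneg fun z _ =>
      mul_nonneg (div_nonneg (W.cond_nonneg _ _) (W.mass_nonneg _)) (hnn z)
  have hl : W.lap h x = W.mass y * W.lap (fun z => W.gr A z y) x := by
    rw [← lap_const_mul]
    congr 1
    ext z; simp only [hh]; ring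
  have hmx := W.mass_pos x
  have hmy := W.mass_pos y
  have e : W.lap h x / W.mass x = - (if x ∈ A ∧ x = y then 1 else 0) := by
    simp only [hh] at key ⊢; linarith
  rw [hl, div_eq_iff hmx.ne'] at e
  by_cases hxy : x = y
  · subst hxy
    rw [if_pos ⟨hx, rfl⟩] at e
    rw [if_pos rfl]
    have : W.mass x * (W.lap (fun z => W.gr A z x) x + 1) = 0 := by linarith
    rcases mul_eq_zero.1 this with h | h
    · exact absurd h hmx.ne'
    · linarith
  · rw [if_neg fun h => hxy h.2] at e
    rw [if_neg hxy]
    have : W.mass y * W.lap (fun z => W.gr A z y) x = 0 := by linarith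
    exact (mul_eq_zero.1 this).resolve_left hmy.ne'

/-- Green's identity for the kernels with poles x and y: each side of the identity picks out one
value. -/
theorem gr_symm [Infinite V] (A : Finset V) (x y : V) : W.gr A x y = W.gr A y x := by
  by_cases hx : x ∈ A
  · by_cases hy : y ∈ A
    · have h := W.sum_mul_lap_comm (S := A) (f := fun z => W.gr A z x) (h := fun z => W.gr A z y)
        (fun z hz => W.gr_left_eq_zero hz x) (fun z hz => W.gr_left_eq_zero hz y)
      have h1 : ∀ u : V → ℝ, ∀ w ∈ A, ∑ z ∈ A, u z * W.lap (fun z => W.gr A z w) z = - u w := by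
        intro u w hw
        rw [Finset.sum_eq_single_of_mem w hw fun z hz hzw => by
          rw [W.lap_gr_left hz, if_neg hzw, mul_zero], W.lap_gr_left hw, if_pos rfl]
        ring
      rw [h1 _ y hy, h1 _ x hx] at h
      linarith
    · rw [W.gr_right_eq_zero x hy, W.gr_left_eq_zero hy]
  · rw [W.gr_left_eq_zero hx, W.gr_right_eq_zero y hx]

theorem lap_gr [Infinite V] {A : Finset V} (x : V) {y : V} (hy : y ∈ A) :
    W.lap (W.gr A x) y = if y = x then -1 else 0 := by
  rw [← W.lap_gr_left hy x]
  congr 1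
  ext z
  exact W.gr_symm A x z

theorem lap_gr_nonpos [Infinite V] {A : Finset V} (x : V) {y : V} (hy : y ∈ A) :
    W.lap (W.gr A x) y ≤ 0 := by
  rw [W.lap_gr x hy]; split_ifs <;> norm_num

theorem lap_gr_of_ne [Infinite V] {A : Finset V} {x y : V} (hy : y ∈ A) (h : y ≠ x) :
    W.lap (W.gr A x) y = 0 := by
  rw [W.lap_gr x hy, if_neg h]

/-- The Green representation of a finitely supported function. -/
theorem sum_mul_lap_gr [Infinite V] {A : Finset V} {f : V → ℝ} {x : V} (hx : x ∈ A) :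
    ∑ z ∈ A, f z * W.lap (W.gr A x) z = - f x := by
  rw [Finset.sum_eq_single_of_mem x hx fun z hz hzw => by
    rw [W.lap_gr_of_ne hz hzw, mul_zero], W.lap_gr x hx, if_pos rfl]
  ring

theorem sum_gr_mul_lap [Infinite V] {A : Finset V} {f : V → ℝ} (hf : ∀ z ∉ A, f z = 0) {x : V}
    (hx : x ∈ A) : ∑ z ∈ A, W.gr A x z * W.lap f z = - f x := by
  rw [W.sum_mul_lap_comm (fun z hz => W.gr_right_eq_zero x hz) hf, W.sum_mul_lap_gr hx]

/-- The Green potential solves the Poisson equation. -/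
theorem lap_potential [Infinite V] {A : Finset V} (k : V → ℝ) {x : V} (hx : x ∈ A) :
    W.lap (fun y => ∑ z ∈ A, W.gr A y z * k z) x = - k x := by
  rw [W.lap_sum A (fun z y => W.gr A y z * k z)]
  have : ∀ z, W.lap (fun y => W.gr A y z * k z) x = k z * (if x = z then -1 else 0) := fun z => by
    rw [← W.lap_gr_left hx, ← lap_const_mul]
    congr 1; ext y; ring
  simp_rw [this]
  rw [Finset.sum_eq_single_of_mem x hx fun z _ hzx => by rw [if_neg (Ne.symm hzx), mul_zero]]
  simp

/-- Monotonicity of the Green kernel in the domain. -/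
theorem gr_mono [Infinite V] {A B : Finset V} (h : A ⊆ B) (x y : V) : W.gr A x y ≤ W.gr B x y := by
  by_cases hy : y ∈ A
  · refine W.le_of_lap_le (A := A) (u := W.gr A x) (v := W.gr B x) (fun z hz => ?_)
      (fun z _ w _ hw => ?_) y hy
    · rw [W.lap_gr x hz, W.lap_gr x (h hz)]
    · rw [W.gr_right_eq_zero x hw]; exact W.gr_nonneg B x w
  · rw [W.gr_right_eq_zero x hy]; exact W.gr_nonneg B x y

/-- The flux of a function out of a finite set that supports it. -/
theorem sum_neg_lap_eq {A : Finset V} {f : V → ℝ} (hf : ∀ z ∉ A, f z = 0) :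
    ∑ z ∈ A, - W.lap f z = ∑ z ∈ A, f z * (W.mass z - ∑ w ∈ A, W.cond z w) := by
  simp only [W.lap_eq_sum_of_support hf, neg_sub, mul_sub, Finset.sum_sub_distrib, Finset.mul_sum]
  congr 1
  · exact Finset.sum_congr rfl fun z _ => mul_comm _ _
  · rw [Finset.sum_comm]
    exact Finset.sum_congr rfl fun z _ => Finset.sum_congr rfl fun w _ => by
      rw [W.cond_symm w z, mul_comm]

/-- The flux of the Green kernel into a finite set outside the domain is at most one. -/
theorem sum_lap_gr_le_one [Infinite V] {A S : Finset V} (hd : Disjoint S A) (x : V) :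
    ∑ w ∈ S, W.lap (W.gr A x) w ≤ 1 := by
  by_cases hx : x ∈ A
  swap
  · have : W.gr A x = fun _ => 0 := funext fun y => W.gr_left_eq_zero hx y
    rw [this]; simp [lap_const]
  have h0 : ∀ z ∉ A, W.gr A x z = 0 := fun z hz => W.gr_right_eq_zero x hz
  -- The kernel vanishes on S, so its Laplacian there is pure inflow from A. The total outflow from
  -- A equals the unit charge at the pole.
  have h1 : ∑ w ∈ S, W.lap (W.gr A x) w = ∑ z ∈ A, W.gr A x z * ∑ w ∈ S, W.cond z w := by
    simp only [Finset.mul_sum]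
    rw [Finset.sum_comm]
    refine Finset.sum_congr rfl fun w hw => ?_
    rw [W.lap_eq_sum_of_support h0, h0 w (Finset.disjoint_left.1 hd hw), mul_zero, sub_zero]
    exact Finset.sum_congr rfl fun z _ => by rw [W.cond_symm w z, mul_comm]
  have h2 : ∑ z ∈ A, W.gr A x z * ∑ w ∈ S, W.cond z w
      ≤ ∑ z ∈ A, W.gr A x z * (W.mass z - ∑ w ∈ A, W.cond z w) := by
    refine Finset.sum_le_sum fun z _ => mul_le_mul_of_nonneg_left ?_ (W.gr_nonneg A x z)
    have := W.sum_cond_le_mass (S ∪ A) z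
    rw [Finset.sum_union hd] at this
    linarith
  have h3 := W.sum_mul_lap_gr (f := fun _ => 1) hx
  rw [← W.sum_neg_lap_eq h0] at h2
  simp only [Finset.sum_neg_distrib, one_mul] at h2 h3
  linarith

end

end WeightedGraph

namespace WeightedGraph

noncomputable section

open scoped Classical

variable {V : Type*} (W : WeightedGraph V)

/-! ### Geodesics and balls -/

/-- Pieces of a shortest walk are shortest: each piece is no longer than its number of edges, and
the triangle inequality over the three pieces forces equality in the middle one. -/
theorem exists_geodesic (a b : V) : ∃ γ : ℕ → V, γ 0 = a ∧ γ (W.graph.dist a b) = b ∧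
    (∀ i < W.graph.dist a b, W.graph.Adj (γ i) (γ (i + 1))) ∧
    ∀ i j, i ≤ j → j ≤ W.graph.dist a b → W.graph.dist (γ i) (γ j) = j - i := by
  obtain ⟨w, hw⟩ := W.connected.exists_walk_length_eq_dist a b
  have hadj : ∀ i < W.graph.dist a b, W.graph.Adj (w.getVert i) (w.getVert (i + 1)) :=
    fun i hi => w.adj_getVert_succ (hw ▸ hi)
  have hle : ∀ i k, i + k ≤ W.graph.dist a b →
      W.graph.dist (w.getVert i) (w.getVert (i + k)) ≤ k := by
    intro i k
    induction k with
    | zero => intro _; simp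
    | succ k ih =>
      intro h
      have h1 := ih (by omega)
      have h2 := SimpleGraph.dist_eq_one_iff_adj.2 (hadj (i + k) (by omega))
      have h3 := W.connected.dist_triangle (u := w.getVert i) (v := w.getVert (i + k))
        (w := w.getVert (i + k + 1))
      rw [← add_assoc]
      omega
  have hend : w.getVert (W.graph.dist a b) = b := by rw [← hw]; exact w.getVert_length
  refine ⟨w.getVert, w.getVert_zero, hend, hadj, fun i j hij hj => ?_⟩
  have h1 := hle 0 i (by omega)
  have h2 := hle i (j - i) (by omega)
  have h3 := hle j (W.graph.dist a b - j) (by omega)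
  rw [zero_add, w.getVert_zero] at h1
  rw [show i + (j - i) = j by omega] at h2
  rw [show j + (W.graph.dist a b - j) = W.graph.dist a b by omega, hend] at h3
  have h4 := W.connected.dist_triangle (u := a) (v := w.getVert i) (w := b)
  have h5 := W.connected.dist_triangle (u := w.getVert i) (v := w.getVert j) (w := b)
  omega

theorem dist_triangle_real (x y z : V) :
    (W.graph.dist x z : ℝ) ≤ W.graph.dist x y + W.graph.dist y z := by
  exact_mod_cast W.connected.dist_triangle

theorem dist_comm_real (x y : V) : (W.graph.dist x y : ℝ) = W.graph.dist y x := by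
  rw [SimpleGraph.dist_comm]

theorem dist_le_add_one {x y z : V} (h : W.graph.Adj y z) :
    W.graph.dist x z ≤ W.graph.dist x y + 1 := by
  have h1 := W.connected.dist_triangle (u := x) (v := y) (w := z)
  rwa [SimpleGraph.dist_eq_one_iff_adj.2 h] at h1

theorem dist_lt_of_adj_real {x y z : V} (h : W.graph.Adj y z) :
    (W.graph.dist x z : ℝ) ≤ W.graph.dist x y + 1 := by
  exact_mod_cast W.dist_le_add_one h

variable [W.LocFinite]

theorem finite_ball (x : V) (R : ℝ) : (W.ball x R).Finite := by
  have key : ∀ n : ℕ, {y | W.graph.dist x y ≤ n}.Finite := by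
    intro n
    induction n with
    | zero =>
      refine (Set.finite_singleton x).subset fun y hy => ?_
      have : W.graph.dist x y = 0 := Nat.le_zero.1 hy
      exact ((W.connected.dist_eq_zero_iff).1 this).symm
    | succ n ih =>
      refine (ih.union (ih.biUnion fun z _ => LocFinite.finite_adj (W := W) z)).subset
        fun y hy => ?_
      obtain ⟨γ, h0, h1, hadj, hd⟩ := W.exists_geodesic x y
      by_cases h : W.graph.dist x y ≤ n
      · exact Or.inl h
      · refine Or.inr (Set.mem_biUnion (x := γ n) ?_ ?_)
        · have := hd 0 n (Nat.zero_le _) (by omega)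
          rw [h0] at this
          exact this.le
        · have hyn : W.graph.dist x y = n + 1 := le_antisymm hy (by omega)
          have := hadj n (by omega)
          rwa [← hyn, h1] at this
  refine (key ⌈R⌉₊).subset fun y hy => ?_
  have : (W.graph.dist x y : ℝ) < ⌈R⌉₊ := lt_of_lt_of_le hy (Nat.le_ceil R)
  exact_mod_cast this.le

/-- The open ball as a finite set. -/
def fball (x : V) (R : ℝ) : Finset V := (W.finite_ball x R).toFinset

theorem mem_fball {x y : V} {R : ℝ} : y ∈ W.fball x R ↔ (W.graph.dist x y : ℝ) < R := by
  simp [fball, ball]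

theorem coe_fball (x : V) (R : ℝ) : (W.fball x R : Set V) = W.ball x R := by simp [fball]

theorem self_mem_fball (x : V) {R : ℝ} (hR : 0 < R) : x ∈ W.fball x R := by
  rw [mem_fball]; simpa using hR

theorem fball_subset {x y : V} {r R : ℝ} (h : W.graph.dist x y + r ≤ R) :
    W.fball y r ⊆ W.fball x R := fun z hz => by
  rw [mem_fball] at hz ⊢
  linarith [W.dist_triangle_real x y z]

theorem fball_mono (x : V) {r R : ℝ} (h : r ≤ R) : W.fball x r ⊆ W.fball x R :=
  W.fball_subset (by simpa using h)

/-- An infinite graph with finite balls has points beyond every distance, and a geodesic to such a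
point meets all smaller spheres. This supplies the base points on spheres used later. -/
theorem exists_dist_eq [Infinite V] (x : V) (n : ℕ) : ∃ y, W.graph.dist x y = n := by
  have hfin := W.finite_ball x n
  obtain ⟨y, hy⟩ := Set.Infinite.nonempty hfin.infinite_compl
  have hy' : n ≤ W.graph.dist x y := by
    simpa [ball] using hy
  obtain ⟨γ, h0, -, -, hd⟩ := W.exists_geodesic x y
  refine ⟨γ n, ?_⟩
  have := hd 0 n (Nat.zero_le _) hy'
  rwa [h0] at this

/-! ### Volumes, mean exit times and Green kernels of balls as real numbers -/

/-- The volume of a ball. -/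
def volR (x : V) (R : ℝ) : ℝ := ∑ y ∈ W.fball x R, W.mass y

/-- The Green kernel of a ball with pole at the centre. -/
def gb (x : V) (R : ℝ) (y : V) : ℝ := W.gr (W.fball x R) x y

/-- The mean exit time from a ball. -/
def exitR (x : V) (R : ℝ) : ℝ := ∑ y ∈ W.fball x R, W.gb x R y * W.mass y

/-- The scale `E(x,2R) / V(x,R)` of the Green kernel. -/
def gscale (x : V) (R : ℝ) : ℝ := W.exitR x (2 * R) / W.volR x R

theorem gb_def (x : V) (R : ℝ) : W.gb x R = W.gr (W.fball x R) x := rfl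

theorem gb_nonneg (x : V) (R : ℝ) (y : V) : 0 ≤ W.gb x R y := W.gr_nonneg _ _ _

theorem gb_eq_zero {x y : V} {R : ℝ} (h : R ≤ W.graph.dist x y) : W.gb x R y = 0 :=
  W.gr_right_eq_zero x (by rw [mem_fball]; exact not_lt.2 h)

theorem vol_eq_ofReal (x : V) (R : ℝ) : W.vol x R = ENNReal.ofReal (W.volR x R) := by
  rw [vol, setMeasure, ← coe_fball, volR, ENNReal.ofReal_sum_of_nonneg fun y _ => W.mass_nonneg y]
  rw [Finset.tsum_subtype' (W.fball x R) fun y => (W.vertexMeasure y : ℝ≥0∞)]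
  exact Finset.sum_congr rfl fun y _ => (ENNReal.ofReal_coe_nnreal).symm

theorem volR_nonneg (x : V) (R : ℝ) : 0 ≤ W.volR x R :=
  Finset.sum_nonneg fun y _ => W.mass_nonneg y

theorem volR_mono_subset {x y : V} {r R : ℝ} (h : W.fball x r ⊆ W.fball y R) :
    W.volR x r ≤ W.volR y R :=
  Finset.sum_le_sum_of_subset_of_nonneg h fun _ _ _ => W.mass_nonneg _

theorem exitR_nonneg (x : V) (R : ℝ) : 0 ≤ W.exitR x R :=
  Finset.sum_nonneg fun y _ => mul_nonneg (W.gb_nonneg x R y) (W.mass_nonneg y)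

variable [Infinite V]

theorem volR_pos (x : V) {R : ℝ} (hR : 0 < R) : 0 < W.volR x R :=
  Finset.sum_pos (fun y _ => W.mass_pos y) ⟨x, W.self_mem_fball x hR⟩

theorem gb_mono (x : V) {r R : ℝ} (h : r ≤ R) (y : V) : W.gb x r y ≤ W.gb x R y :=
  W.gr_mono (W.fball_mono x h) x y

theorem exitR_mono (x : V) {r R : ℝ} (h : r ≤ R) : W.exitR x r ≤ W.exitR x R :=
  (Finset.sum_le_sum fun y _ => mul_le_mul_of_nonneg_right (W.gb_mono x h y) (W.mass_nonneg y)).trans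
    (Finset.sum_le_sum_of_subset_of_nonneg (W.fball_mono x h) fun y _ _ =>
      mul_nonneg (W.gb_nonneg x R y) (W.mass_nonneg y))

theorem mass_mul_gb_self_ge_one (x : V) {R : ℝ} (hR : 0 < R) : 1 ≤ W.gb x R x * W.mass x := by
  have h := W.lap_gr (A := W.fball x R) x (W.self_mem_fball x hR)
  rw [if_pos rfl, lap_eq] at h
  have : 0 ≤ ∑ y ∈ W.nbrs x, W.cond x y * W.gr (W.fball x R) x y :=
    Finset.sum_nonneg fun y _ => mul_nonneg (W.cond_nonneg x y) (W.gr_nonneg _ _ _)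
  rw [gb, mul_comm]; linarith

theorem exitR_pos (x : V) {R : ℝ} (hR : 0 < R) : 0 < W.exitR x R := by
  have h1 := W.mass_mul_gb_self_ge_one x hR
  have h2 := Finset.single_le_sum (s := W.fball x R) (f := fun y => W.gb x R y * W.mass y)
    (fun y _ => mul_nonneg (W.gb_nonneg x R y) (W.mass_nonneg y)) (W.self_mem_fball x hR)
  have h3 : W.gb x R x * W.mass x ≤ W.exitR x R := h2
  linarith

theorem gscale_pos (x : V) {R : ℝ} (hR : 0 < R) : 0 < W.gscale x R :=
  div_pos (W.exitR_pos x (by positivity)) (W.volR_pos x hR)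

theorem meanExit_eq_ofReal [Countable V] [MeasurableSpace V] [DiscreteMeasurableSpace V]
    (x : V) (R : ℝ) : W.meanExit x R = ENNReal.ofReal (W.exitR x R) := by
  rw [meanExit, meanExitFrom_eq_tsum, ← coe_fball, exitR, ENNReal.ofReal_sum_of_nonneg fun y _ =>
      mul_nonneg (W.gb_nonneg x R y) (W.mass_nonneg y)]
  rw [tsum_eq_sum (s := W.fball x R) fun y hy =>
    W.greenFunction_eq_zero_of_notMem_right (by simpa using hy) x]
  exact Finset.sum_congr rfl fun y _ => W.greenFunction_eq_ofReal _ x y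

theorem meanExit_div_vol [Countable V] [MeasurableSpace V] [DiscreteMeasurableSpace V]
    (x : V) {R : ℝ} (hR : 0 < R) :
    W.meanExit x (2 * R) / W.vol x R = ENNReal.ofReal (W.gscale x R) := by
  rw [meanExit_eq_ofReal, vol_eq_ofReal, gscale, ENNReal.ofReal_div_of_pos (W.volR_pos x hR)]

theorem greenKernelBounds_iff [Countable V] [MeasurableSpace V] [DiscreteMeasurableSpace V] :
    W.GreenKernelBounds ↔ ∃ C c : ℝ, 0 < C ∧ 0 < c ∧ ∀ (x : V) (R : ℝ), 0 < R →
      (∀ y, R ≤ W.graph.dist x y → W.gb x (2 * R) y ≤ C * W.gscale x R) ∧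
      ∀ y, (W.graph.dist x y : ℝ) < R → c * W.gscale x R ≤ W.gb x (2 * R) y := by
  have e1 : ∀ (C : ℝ≥0) x (R : ℝ), 0 < R → ((⨆ y ∈ (W.ball x R)ᶜ,
      W.greenKernel (W.ball x (2 * R)) x y) ≤ C * (W.meanExit x (2 * R) / W.vol x R) ↔
      ∀ y, R ≤ W.graph.dist x y → W.gb x (2 * R) y ≤ C * W.gscale x R) := by
    intro C x R hR
    rw [iSup₂_le_iff, W.meanExit_div_vol x hR, ← coe_fball W x (2 * R)]
    refine forall_congr' fun y => ?_
    rw [greenKernel_eq_ofReal, ← ENNReal.ofReal_coe_nnreal, ← ENNReal.ofReal_mul (NNReal.coe_nonneg C),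
      ENNReal.ofReal_le_ofReal_iff (mul_nonneg (NNReal.coe_nonneg C) (W.gscale_pos x hR).le)]
    simp [ball, gb]
  have e2 : ∀ (c : ℝ≥0) x (R : ℝ), 0 < R → (c * (W.meanExit x (2 * R) / W.vol x R) ≤
      (⨅ y ∈ W.ball x R, W.greenKernel (W.ball x (2 * R)) x y) ↔
      ∀ y, (W.graph.dist x y : ℝ) < R → c * W.gscale x R ≤ W.gb x (2 * R) y) := by
    intro c x R hR
    rw [le_iInf₂_iff, W.meanExit_div_vol x hR, ← coe_fball W x (2 * R)]
    refine forall_congr' fun y => ?_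
    rw [greenKernel_eq_ofReal, ← ENNReal.ofReal_coe_nnreal, ← ENNReal.ofReal_mul (NNReal.coe_nonneg c),
      ENNReal.ofReal_le_ofReal_iff (W.gr_nonneg _ _ _)]
    simp [ball, gb]
  constructor
  · rintro ⟨C, c, hC, hc, h⟩
    exact ⟨C, c, hC, hc, fun x R hR => ⟨(e1 C x R hR).1 (h x R hR).1, (e2 c x R hR).1 (h x R hR).2⟩⟩
  · rintro ⟨C, c, hC, hc, h⟩
    refine ⟨⟨C, hC.le⟩, ⟨c, hc.le⟩, hC, hc, fun x R hR =>
      ⟨(e1 _ x R hR).2 (h x R hR).1, (e2 _ x R hR).2 (h x R hR).2⟩⟩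


end

end WeightedGraph

namespace WeightedGraph

noncomputable section

open scoped Classical

variable {V : Type*} (W : WeightedGraph V)

/-! ### Consequences of the controlled weights and of volume doubling -/

/-- The transition probabilities along the edges are at least `p`. -/
structure Elliptic (p : ℝ) : Prop where
  pos : 0 < p
  le_one : p ≤ 1
  mul_mass_le : ∀ x y, W.graph.Adj x y → p * W.mass x ≤ W.cond x y

theorem ControlledWeights.exists_elliptic [Infinite V] {W : WeightedGraph V}
    (h : W.ControlledWeights) : ∃ p, W.Elliptic p := by
  obtain ⟨p, hp, hP⟩ := h
  refine ⟨min p 1, lt_min hp one_pos, min_le_right _ _, fun x y hxy => ?_⟩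
  have h1 : (p : ℝ) ≤ W.cond x y / W.mass x := by
    have := hP x y hxy
    rw [← NNReal.coe_le_coe] at this
    simpa [transition, cond, mass] using this
  rw [le_div_iff₀ (W.mass_pos x)] at h1
  exact (mul_le_mul_of_nonneg_right (min_le_left _ _) (W.mass_nonneg x)).trans h1

/-- The weights at x are summable, hence tend to zero, while every edge at x carries at least p
μ(x). -/
theorem Elliptic.locFinite [Infinite V] {W : WeightedGraph V} {p : ℝ} (hp : W.Elliptic p) :
    W.LocFinite := by
  refine ⟨fun x => ?_⟩
  have h : Filter.Tendsto (W.weight x) Filter.cofinite (nhds 0) :=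
    NNReal.tendsto_cofinite_zero_of_summable (W.weight_summable x)
  have hpos : 0 < p * W.mass x := mul_pos hp.pos (W.mass_pos x)
  have h2 : ∀ᶠ y in Filter.cofinite, W.weight x y < (p * W.mass x).toNNReal :=
    h.eventually (gt_mem_nhds (Real.toNNReal_pos.2 hpos))
  refine (Filter.eventually_cofinite.1 h2).subset fun y hy => ?_
  refine not_lt.2 (Real.toNNReal_le_iff_le_coe.2 ?_)
  exact hp.mul_mass_le x y hy

section

variable [W.LocFinite]

variable {W} in
/-- One step of a walk through superharmonic points. -/
theorem Elliptic.mul_le [Infinite V] {p : ℝ} (hp : W.Elliptic p) {u : V → ℝ} {x y : V}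
    (hu : W.lap u x ≤ 0) (hnn : ∀ z, W.graph.Adj x z → 0 ≤ u z) (hxy : W.graph.Adj x y) :
    p * u y ≤ u x := by
  rw [lap_eq] at hu
  have h1 := Finset.single_le_sum (s := W.nbrs x) (f := fun z => W.cond x z * u z)
    (fun z hz => mul_nonneg (W.cond_nonneg x z) (hnn z (W.mem_nbrs.1 hz))) (W.mem_nbrs.2 hxy)
  have h2 := mul_le_mul_of_nonneg_right (hp.mul_mass_le x y hxy) (hnn y hxy)
  have h3 : W.mass x * (p * u y) ≤ W.mass x * u x := by
    have h1' : W.cond x y * u y ≤ ∑ z ∈ W.nbrs x, W.cond x z * u z := h1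
    nlinarith
  exact le_of_mul_le_mul_left h3 (W.mass_pos x)

/-- Volume doubling with constant `D`, in terms of real numbers. -/
structure Doubling (D : ℝ) : Prop where
  one_le : 1 ≤ D
  le_mul : ∀ x R, 0 < R → W.volR x (2 * R) ≤ D * W.volR x R

variable {W} in
theorem VolumeDoubling.exists_doubling (h : W.VolumeDoubling) :
    ∃ D, W.Doubling D := by
  obtain ⟨D, -, hD⟩ := h
  refine ⟨max D 1, le_max_right _ _, fun x R hR => ?_⟩
  have h1 := hD x R hR
  rw [vol_eq_ofReal, vol_eq_ofReal, ← ENNReal.ofReal_coe_nnreal, ← ENNReal.ofReal_mul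
    (NNReal.coe_nonneg D), ENNReal.ofReal_le_ofReal_iff
    (mul_nonneg (NNReal.coe_nonneg D) (W.volR_nonneg x R))] at h1
  exact h1.trans (mul_le_mul_of_nonneg_right (le_max_left _ _) (W.volR_nonneg x R))

variable {W} in
theorem Doubling.le_pow_mul {D : ℝ} (h : W.Doubling D) (x : V) {R : ℝ} (hR : 0 < R) (k : ℕ) :
    W.volR x (2 ^ k * R) ≤ D ^ k * W.volR x R := by
  induction k with
  | zero => simp
  | succ k ih =>
    have h1 := h.le_mul x (2 ^ k * R) (by positivity)
    have h0 : 0 ≤ D := zero_le_one.trans h.one_le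
    calc W.volR x (2 ^ (k + 1) * R) = W.volR x (2 * (2 ^ k * R)) := by ring_nf
      _ ≤ D * W.volR x (2 ^ k * R) := h1
      _ ≤ D * (D ^ k * W.volR x R) := mul_le_mul_of_nonneg_left ih h0
      _ = D ^ (k + 1) * W.volR x R := by ring

theorem harmonicOn_iff [Infinite V] {u : V → ℝ} {A : Set V} :
    W.HarmonicOn u A ↔ ∀ x ∈ A, W.lap u x = 0 := by
  refine forall₂_congr fun x _ => ?_
  have h0 : ∀ y ∉ W.nbrs x, (W.transition x y : ℝ) * u y = 0 := fun y hy => by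
    have : W.transition x y = 0 := by
      have h1 := W.cond_eq_zero (fun h => hy (W.mem_nbrs.2 h))
      rw [transition, NNReal.coe_eq_zero.1 h1, zero_div]
    rw [this]; simp
  have hs : HasSum (fun y => (W.transition x y : ℝ) * u y) _ :=
    hasSum_sum_of_ne_finset_zero h0
  have he : ∑ y ∈ W.nbrs x, (W.transition x y : ℝ) * u y
      = (∑ y ∈ W.nbrs x, W.cond x y * u y) / W.mass x := by
    rw [Finset.sum_div]
    refine Finset.sum_congr rfl fun y _ => ?_
    simp only [transition, cond, mass, NNReal.coe_div]; ring
  have hm := W.mass_pos x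
  rw [lap_eq]
  constructor
  · intro h
    have := h.unique hs
    rw [he, eq_div_iff hm.ne'] at this
    linarith
  · intro h
    have : u x = ∑ y ∈ W.nbrs x, (W.transition x y : ℝ) * u y := by
      rw [he, eq_div_iff hm.ne']; linarith
    rw [this]; exact hs

end

/-- Propagation of a lower bound along a chain with steps of length at most `k`. -/
theorem chain_bound {P : ℕ → ℝ → Prop} {q : ℝ} {k n L : ℕ} (hq : 0 ≤ q)
    (step : ∀ i j α, i ≤ j → j ≤ i + k → j ≤ L → 0 ≤ α → P i α → P j (q * α)) (hL : L ≤ n * k)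
    {α : ℝ} (hα : 0 ≤ α) (h0 : P 0 α) : P L (q ^ n * α) := by
  -- Positions are capped at L, so the last steps may be shorter than k or even trivial; this is why
  -- `step` admits i = j.
  have key : ∀ m : ℕ, P (min (m * k) L) (q ^ m * α) := by
    intro m
    induction m with
    | zero => simpa using h0
    | succ m ih =>
      have h1 : (m + 1) * k = m * k + k := by ring
      have := step (min (m * k) L) (min ((m + 1) * k) L) (q ^ m * α) (by omega) (by omega)
        (min_le_right _ _) (by positivity) ih
      rwa [show q ^ (m + 1) * α = q * (q ^ m * α) by ring]
  have := key n
  rwa [min_eq_right hL] at this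

variable [W.LocFinite] [Infinite V]

/-! ### The resistance of an annulus and the Green kernel -/

theorem laplacian_mul_mass (f : V → ℝ) (x : V) : W.laplacian f x * W.mass x = W.lap f x := by
  have h0 : ∀ y ∉ W.nbrs x, (W.transition x y : ℝ) * f y = 0 := fun y hy => by
    have : W.transition x y = 0 := by
      have h1 := W.cond_eq_zero (fun h => hy (W.mem_nbrs.2 h))
      rw [transition, NNReal.coe_eq_zero.1 h1, zero_div]
    rw [this]; simp
  rw [laplacian, markovOp, tsum_eq_sum h0, lap_eq, sub_mul, Finset.sum_mul]
  congr 1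
  · refine Finset.sum_congr rfl fun y _ => ?_
    have hm := (W.mass_pos x).ne'
    have : (W.transition x y : ℝ) = W.cond x y / W.mass x := by simp [transition, cond, mass]
    rw [this]; field_simp
  · ring

theorem innerMu_neg_laplacian {f : V → ℝ} {S : Finset V} (hf : ∀ y ∉ S, f y = 0) :
    W.innerMu (fun x => - W.laplacian f x) f = - ∑ x ∈ S, f x * W.lap f x := by
  rw [innerMu, tsum_eq_sum (s := S) fun y hy => by rw [hf y hy]; ring, ← Finset.sum_neg_distrib]
  refine Finset.sum_congr rfl fun x _ => ?_
  rw [← laplacian_mul_mass, mass]; ring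

/-- Below the level M the truncation touches the superharmonic kernel from below; above it, the
point is a maximum of the truncation. -/
theorem lap_min_gr_nonpos {A : Finset V} (x : V) (M : ℝ) {z : V} (hz : z ∈ A) :
    W.lap (fun y => min (W.gr A x y) M) z ≤ 0 := by
  rcases le_total (W.gr A x z) M with h | h
  · exact (W.lap_le_of_le (v := W.gr A x) (min_eq_left h) fun y _ => min_le_left _ _).trans
      (W.lap_gr_nonpos x hz)
  · refine W.lap_nonpos_of_max fun y _ => ?_
    rw [min_eq_right h]
    exact min_le_right _ _

/-- The energy of a truncated Green kernel. -/
theorem energy_min_gr_le {A : Finset V} {x : V} (hx : x ∈ A) {M : ℝ} (hM : 0 ≤ M) :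
    - ∑ z ∈ A, min (W.gr A x z) M * W.lap (fun y => min (W.gr A x y) M) z ≤ M := by
  have h0 : ∀ z ∉ A, W.gr A x z = 0 := fun z hz => W.gr_right_eq_zero x hz
  have h1 : ∀ z ∉ A, min (W.gr A x z) M = 0 := fun z hz => by rw [h0 z hz, min_eq_left hM]
  have hk : ∀ z ∈ A, 0 ≤ W.mass z - ∑ w ∈ A, W.cond z w :=
    fun z _ => sub_nonneg.2 (W.sum_cond_le_mass A z)
  -- Bounding the first factor by M leaves the total charge of the truncation, which is its flux out
  -- of A. That flux is at most the flux of the kernel itself, which is one.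
  calc - ∑ z ∈ A, min (W.gr A x z) M * W.lap (fun y => min (W.gr A x y) M) z
      = ∑ z ∈ A, min (W.gr A x z) M * - W.lap (fun y => min (W.gr A x y) M) z := by
        rw [← Finset.sum_neg_distrib]; exact Finset.sum_congr rfl fun z _ => by ring
    _ ≤ ∑ z ∈ A, M * - W.lap (fun y => min (W.gr A x y) M) z :=
        Finset.sum_le_sum fun z hz => mul_le_mul_of_nonneg_right (min_le_right _ _)
          (neg_nonneg.2 (W.lap_min_gr_nonpos x M hz))
    _ = M * ∑ z ∈ A, min (W.gr A x z) M * (W.mass z - ∑ w ∈ A, W.cond z w) := by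
        rw [← Finset.mul_sum, W.sum_neg_lap_eq (f := fun y => min (W.gr A x y) M) h1]
    _ ≤ M * ∑ z ∈ A, W.gr A x z * (W.mass z - ∑ w ∈ A, W.cond z w) :=
        mul_le_mul_of_nonneg_left (Finset.sum_le_sum fun z hz =>
          mul_le_mul_of_nonneg_right (min_le_left _ _) (hk z hz)) hM
    _ = M := by
        rw [← W.sum_neg_lap_eq h0, Finset.sum_neg_distrib]
        have := W.sum_mul_lap_gr (f := fun _ => 1) hx
        simp only [one_mul] at this
        rw [this]; ring

/-- The truncated kernel min(g,κ)/κ is admissible because g ≥ κ on the inner ball, and its energy is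
at most 1/κ. -/
theorem le_annulusResistance {x : V} {R κ : ℝ} (hR : 0 < R) (hκ : 0 < κ)
    (h : ∀ y, (W.graph.dist x y : ℝ) < R → κ ≤ W.gb x (2 * R) y) :
    ENNReal.ofReal κ ≤ W.annulusResistance x R (2 * R) := by
  have hx := W.self_mem_fball x (show 0 < 2 * R by positivity)
  have hsupp : ∀ z ∉ W.fball x (2 * R), κ⁻¹ * min (W.gr (W.fball x (2 * R)) x z) κ = 0 :=
    fun z hz => by rw [W.gr_right_eq_zero x hz, min_eq_left hκ.le, mul_zero]
  let f : V →₀ ℝ := Finsupp.onFinset (W.fball x (2 * R))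
    (fun z => κ⁻¹ * min (W.gr (W.fball x (2 * R)) x z) κ)
    (fun z hz => by_contra fun hc => hz (hsupp z hc))
  have hf : (f : V → ℝ) = fun z => κ⁻¹ * min (W.gr (W.fball x (2 * R)) x z) κ := rfl
  rw [annulusResistance, resistance, ENNReal.le_inv_iff_le_inv, ← ENNReal.ofReal_inv_of_pos hκ]
  have hfA : (∀ z ∈ W.ball x R, f z = 1) ∧ ∀ z ∈ (W.ball x (2 * R))ᶜ, f z = 0 := by
    refine ⟨fun z hz => ?_, fun z hz => ?_⟩
    · rw [hf]
      have := h z hz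
      rw [gb] at this
      simp only [min_eq_right this, inv_mul_cancel₀ hκ.ne']
    · rw [hf]
      refine hsupp z ?_
      rw [mem_fball]
      exact fun hc => hz hc
  refine (iInf₂_le f hfA).trans (ENNReal.ofReal_le_ofReal ?_)
  · rw [W.innerMu_neg_laplacian (S := W.fball x (2 * R)) (by rw [hf]; exact hsupp), hf]
    simp only [lap_const_mul]
    have h1 := W.energy_min_gr_le hx hκ.le
    have h2 : - ∑ z ∈ W.fball x (2 * R), κ⁻¹ * min (W.gr (W.fball x (2 * R)) x z) κ *
        (κ⁻¹ * W.lap (fun y => min (W.gr (W.fball x (2 * R)) x y) κ) z)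
        = κ⁻¹ * κ⁻¹ * - ∑ z ∈ W.fball x (2 * R), min (W.gr (W.fball x (2 * R)) x z) κ *
          W.lap (fun y => min (W.gr (W.fball x (2 * R)) x y) κ) z := by
      rw [mul_neg, Finset.mul_sum]
      congr 1
      exact Finset.sum_congr rfl fun z _ => by ring
    rw [h2]
    calc _ ≤ κ⁻¹ * κ⁻¹ * κ := mul_le_mul_of_nonneg_left h1 (by positivity)
      _ = κ⁻¹ := by field_simp

/-- The truncation w = min(g,N) at N = M/p is dual to every admissible f: its Laplacian pairs with f
to -1 and its energy is at most N. Hence f has energy at least 1/N. The loss of the factor p pays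
for one edge across the boundary of B(x,R). -/
theorem annulusResistance_le {p : ℝ} (hp : W.Elliptic p) {x : V} {R M : ℝ} (hR : 1 / 2 < R)
    (hM : 0 < M) (h : ∀ y, R ≤ W.graph.dist x y → W.gb x (2 * R) y ≤ M) :
    W.annulusResistance x R (2 * R) ≤ ENNReal.ofReal (M / p) := by
  have hp0 := hp.pos
  have hR0 : 0 < R := by linarith
  set A := W.fball x (2 * R) with hA
  have hx : x ∈ A := W.self_mem_fball x (show 0 < 2 * R by positivity)
  set N := M / p with hN
  have hN0 : 0 < N := div_pos hM hp0
  have hMN : M ≤ N := by rw [hN, le_div_iff₀ hp0]; nlinarith [hp.le_one]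
  rw [annulusResistance, resistance, ENNReal.inv_le_iff_inv_le, ← ENNReal.ofReal_inv_of_pos hN0]
  refine le_iInf₂ fun f hf => ENNReal.ofReal_le_ofReal ?_
  have hf1 : ∀ z, (W.graph.dist x z : ℝ) < R → f z = 1 := hf.1
  have hf0 : ∀ z ∉ A, f z = 0 := fun z hz => hf.2 z fun hc => hz (by rw [hA, mem_fball]; exact hc)
  rw [W.innerMu_neg_laplacian hf0]
  set w : V → ℝ := fun z => min (W.gr A x z) N with hw
  set v : V → ℝ := fun z => W.gr A x z - w z with hv
  have hg0 : ∀ z ∉ A, W.gr A x z = 0 := fun z hz => W.gr_right_eq_zero x hz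
  have hw0 : ∀ z ∉ A, w z = 0 := fun z hz => by simp only [hw]; rw [hg0 z hz, min_eq_left hN0.le]
  have hv0 : ∀ z ∉ A, v z = 0 := fun z hz => by simp only [hv]; rw [hg0 z hz, hw0 z hz, sub_zero]
  -- The excess v = g - w lives where g > N. Such a point lies in B(x,R) with all its neighbours,
  -- since a neighbour outside has g ≤ M = pN and one edge loses at most the factor p. So f equals 1
  -- around it and is harmonic there.
  have hvf : ∑ z ∈ A, f z * W.lap v z = 0 := by
    rw [W.sum_mul_lap_comm hf0 hv0]
    refine Finset.sum_eq_zero fun z _ => ?_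
    rcases le_or_gt (W.gr A x z) N with hz | hz
    · simp only [hv, hw, min_eq_left hz, sub_self, zero_mul]
    · have hzR : (W.graph.dist x z : ℝ) < R := by
        by_contra hc
        have := h z (not_lt.1 hc)
        rw [gb] at this
        linarith
      have hnb : ∀ y, W.graph.Adj z y → (W.graph.dist x y : ℝ) < R := by
        intro y hzy
        by_contra hc
        rw [not_lt] at hc
        have hy1 := W.dist_le_add_one (x := x) hzy
        have hy2 : (W.graph.dist x y : ℝ) < 2 * R := by
          rcases lt_or_ge R 1 with hR1 | hR1
          · have : W.graph.dist x z = 0 := by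
              have : (W.graph.dist x z : ℝ) < (1 : ℕ) := by simpa using hzR.trans hR1
              have := Nat.cast_lt.1 this
              omega
            have h2 : W.graph.dist x y ≤ 1 := by omega
            have h3 : (W.graph.dist x y : ℝ) ≤ 1 := by exact_mod_cast h2
            linarith
          · have h3 : (W.graph.dist x y : ℝ) ≤ W.graph.dist x z + 1 := by exact_mod_cast hy1
            linarith
        have hyx : y ≠ x := by
          rintro rfl
          simp at hc
          linarith
        have h4 := hp.mul_le (u := W.gr A x) (x := y) (y := z)
          (W.lap_gr_of_ne (by rw [hA, mem_fball]; exact hy2) hyx).le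
          (fun _ _ => W.gr_nonneg _ _ _) hzy.symm
        have h5 := h y hc
        rw [gb, ← hA] at h5
        have h6 : p * N = M := by rw [hN]; field_simp
        nlinarith
      rw [W.lap_congr (v := fun _ => 1) (hf1 z hzR) fun y hy => hf1 y (hnb y hy), lap_const,
        mul_zero]
  have hfu : ∑ z ∈ A, f z * W.lap (W.gr A x) z = -1 := by
    rw [W.sum_mul_lap_gr hx, hf1 x (by simpa using hR0)]
  have hfw : ∑ z ∈ A, f z * W.lap w z = -1 := by
    have : ∀ z, W.lap w z = W.lap (W.gr A x) z - W.lap v z := fun z => by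
      rw [← lap_sub]; congr 1; ext y; simp [hv]
    simp only [this, mul_sub, Finset.sum_sub_distrib, hfu, hvf]
    ring
  have hwf : ∑ z ∈ A, w z * W.lap f z = -1 := by rw [W.sum_mul_lap_comm hw0 hf0, hfw]
  have hww := W.energy_min_gr_le hx hN0.le
  -- Positivity of the energy of f - w/N replaces the Cauchy–Schwarz inequality: it bounds the
  -- energy of f below by 2/N - 1/N.
  have hpos := W.sum_mul_lap_nonpos (S := A) (f := fun z => f z - N⁻¹ * w z)
    (fun z hz => by rw [hf0 z hz, hw0 z hz]; ring)
  have hexp : ∑ z ∈ A, (f z - N⁻¹ * w z) * W.lap (fun z => f z - N⁻¹ * w z) z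
      = ∑ z ∈ A, f z * W.lap f z - N⁻¹ * ∑ z ∈ A, f z * W.lap w z
        - N⁻¹ * ∑ z ∈ A, w z * W.lap f z + N⁻¹ * N⁻¹ * ∑ z ∈ A, w z * W.lap w z := by
    simp only [Finset.mul_sum]
    rw [← Finset.sum_sub_distrib, ← Finset.sum_sub_distrib, ← Finset.sum_add_distrib]
    refine Finset.sum_congr rfl fun z _ => ?_
    rw [W.lap_sub f (fun z => N⁻¹ * w z), lap_const_mul]; ring
  rw [hexp, hfw, hwf] at hpos
  have hlast : N⁻¹ * N⁻¹ * (- ∑ z ∈ A, w z * W.lap w z) ≤ N⁻¹ * N⁻¹ * N :=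
    mul_le_mul_of_nonneg_left hww (by positivity)
  have hNN : N⁻¹ * N⁻¹ * N = N⁻¹ := by field_simp
  linarith

end

end WeightedGraph

namespace WeightedGraph

noncomputable section

open scoped Classical

/-! ### From the Harnack inequality and the Einstein relation to the Green kernel -/

variable {V : Type*} {W : WeightedGraph V}

/-- Points near a geodesic from the centre to the sphere of radius `n` stay inside the ball and away
from a point of the sphere that is far from the end of the geodesic. -/
theorem near_geodesic {x a b z w : V} {n : ℕ} {R : ℝ} (hnR : (n : ℝ) < 2 * R) (hRn : (n : ℝ) < R + 1)
    (hn : 0 < n) (ha : W.graph.dist x a = n) (hb : W.graph.dist x b = n)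
    (hab : (n : ℝ) / 3 ≤ W.graph.dist a b)
    (hz : W.graph.dist x z + W.graph.dist z b = n)
    (hw : (W.graph.dist z w : ℝ) < 2 * max ((n : ℝ) / 12) (1 / 2)) :
    (W.graph.dist x w : ℝ) < 2 * R ∧ w ≠ a := by
  have hn' : (0 : ℝ) < n := by exact_mod_cast hn
  have hzr : (W.graph.dist x z : ℝ) + W.graph.dist z b = n := by exact_mod_cast hz
  have ha' : (W.graph.dist x a : ℝ) = n := by rw [ha]
  have hb' : (W.graph.dist x b : ℝ) = n := by rw [hb]
  have hzb0 : (0 : ℝ) ≤ W.graph.dist z b := Nat.cast_nonneg _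
  have t1 := W.dist_triangle_real x z w
  have t2 := W.dist_triangle_real x z a
  have t3 := W.dist_triangle_real a z b
  have t4 := W.dist_comm_real a z
  by_cases h6 : n < 6
  · have h6' : (n : ℝ) ≤ 5 := by exact_mod_cast (by omega)
    rw [max_eq_right (by linarith)] at hw
    have hzw : z = w := by
      have : (W.graph.dist z w : ℝ) < (1 : ℕ) := by push_cast; linarith
      have := Nat.cast_lt.1 this
      exact W.connected.dist_eq_zero_iff.1 (by omega)
    subst hzw
    refine ⟨by linarith, ?_⟩
    rintro rfl
    have : (0 : ℝ) ≤ W.graph.dist x z := Nat.cast_nonneg _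
    linarith
  · have h6' : (6 : ℝ) ≤ n := by exact_mod_cast (by omega)
    rw [max_eq_left (by linarith)] at hw
    -- If w = a, then d(x,z) > n - n/6, so d(z,b) < n/6 and d(a,b) < n/3, a contradiction.
    refine ⟨by linarith, ?_⟩
    rintro rfl
    linarith

variable [W.LocFinite]

theorem mul_volR_le_exitR {x : V} {R m : ℝ} (hR : 0 < R)
    (h : ∀ y, (W.graph.dist x y : ℝ) < R → m ≤ W.gb x (2 * R) y) :
    m * W.volR x R ≤ W.exitR x (2 * R) := by
  rw [volR, Finset.mul_sum]
  refine (Finset.sum_le_sum fun y hy => mul_le_mul_of_nonneg_right (h y (W.mem_fball.1 hy))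
    (W.mass_nonneg y)).trans ?_
  exact Finset.sum_le_sum_of_subset_of_nonneg (W.fball_mono x (by linarith)) fun y _ _ =>
    mul_nonneg (W.gb_nonneg _ _ _) (W.mass_nonneg y)

variable [Infinite V]

variable (W) in
/-- The elliptic Harnack inequality with constant `H` for functions that are nonnegative
everywhere. -/
structure Harnack (H : ℝ) : Prop where
  one_le : 1 ≤ H
  le_mul : ∀ (x : V) (R : ℝ) (u : V → ℝ), 0 < R →
    (∀ z, (W.graph.dist x z : ℝ) < 2 * R → W.lap u z = 0) → (∀ z, 0 ≤ u z) →
    ∀ y, (W.graph.dist x y : ℝ) < R → ∀ z, (W.graph.dist x z : ℝ) < R → u y ≤ H * u z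

theorem EllipticHarnack.exists_harnack (h : W.EllipticHarnack) : ∃ H, W.Harnack H := by
  obtain ⟨H, hH, h⟩ := h
  exact ⟨H, hH.le, fun x R u hR hu hnn y hy z hz =>
    h x R hR u (W.harmonicOn_iff.2 fun w hw => hu w hw) (fun w _ => hnn w) y hy z hz⟩

/-- The Harnack inequality along a geodesic. -/
theorem Harnack.chain {p H : ℝ} (hp : W.Elliptic p) (hH : W.Harnack H) {u : V → ℝ}
    (hnn : ∀ z, 0 ≤ u z) {a b : V} {s : ℝ} (hs : 0 < s) {n : ℕ} (hn : W.graph.dist a b ≤ n * s)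
    (hu : ∀ z, W.graph.dist a z + W.graph.dist z b = W.graph.dist a b →
      ∀ w, (W.graph.dist z w : ℝ) < 2 * s → W.lap u w = 0) :
    (p / H) ^ (2 * n) * u a ≤ u b := by
  obtain ⟨γ, h0, h1, hadj, hd⟩ := W.exists_geodesic a b
  have hH0 : 0 < H := zero_lt_one.trans_le hH.one_le
  have hq : 0 ≤ p / H := (div_pos hp.pos hH0).le
  have hqp : p / H ≤ p := div_le_self hp.pos.le hH.one_le
  have hq1 : p / H ≤ 1 := hqp.trans hp.le_one
  have hgeo : ∀ j ≤ W.graph.dist a b,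
      W.graph.dist a (γ j) + W.graph.dist (γ j) b = W.graph.dist a b := by
    intro j hj
    have e1 := hd 0 j (Nat.zero_le _) hj
    have e2 := hd j _ hj le_rfl
    rw [h0] at e1
    rw [h1] at e2
    omega
  -- For s > 1 this is the largest integer below s, so that k edges stay within the open ball of
  -- radius s. For s ≤ 1 single edges are used, with loss p instead of 1/H. In both cases s ≤ 2k,
  -- hence 2n steps.
  set k : ℕ := if s ≤ 1 then 1 else ⌈s⌉₊ - 1 with hk
  have hsk : s ≤ 2 * k := by
    by_cases h : s ≤ 1
    · rw [hk, if_pos h]; push_cast; linarith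
    · rw [hk, if_neg h]
      have h2 : 1 < ⌈s⌉₊ := Nat.lt_ceil.2 (by simpa using h)
      have h3 := Nat.le_ceil s
      have h4 : (⌈s⌉₊ : ℝ) ≤ ((2 * (⌈s⌉₊ - 1) : ℕ) : ℝ) := by exact_mod_cast (by omega)
      push_cast at h4 ⊢
      linarith
  have key := chain_bound (P := fun i α => α ≤ u (γ i)) (k := k) (n := 2 * n)
    (L := W.graph.dist a b) (α := u a) hq ?_ ?_ (hnn a) (by rw [h0])
  · rwa [h1] at key
  · intro i j α hij hjk hjL hα hi
    rcases hij.eq_or_lt with rfl | hlt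
    · exact (mul_le_of_le_one_left hα hq1).trans hi
    by_cases h : s ≤ 1
    · rw [hk, if_pos h] at hjk
      obtain rfl : j = i + 1 := by omega
      have hl : W.lap u (γ (i + 1)) = 0 :=
        hu (γ (i + 1)) (hgeo _ hjL) (γ (i + 1)) (by simpa using hs)
      calc p / H * α ≤ p * u (γ i) := mul_le_mul hqp hi hα hp.pos.le
        _ ≤ u (γ (i + 1)) := hp.mul_le hl.le (fun z _ => hnn z) (hadj i (by omega)).symm
    · rw [hk, if_neg h] at hjk
      have hdij : (W.graph.dist (γ i) (γ j) : ℝ) < s := by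
        rw [hd i j hij hjL]
        refine Nat.lt_ceil.1 ?_
        have h2 : 1 < ⌈s⌉₊ := Nat.lt_ceil.2 (by simpa using h)
        omega
      have hle := hH.le_mul (γ i) s u hs (fun w hw => hu (γ i) (hgeo i (by omega)) w hw) hnn (γ i)
        (by simpa using hs) (γ j) hdij
      calc p / H * α ≤ p / H * (H * u (γ j)) :=
            mul_le_mul_of_nonneg_left (le_trans hi hle) hq
        _ = p * u (γ j) := by field_simp
        _ ≤ u (γ j) := mul_le_of_le_one_left (hnn _) hp.le_one
  · have : (W.graph.dist a b : ℝ) ≤ ((2 * n * k : ℕ) : ℝ) := by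
      push_cast
      calc (W.graph.dist a b : ℝ) ≤ n * s := hn
        _ ≤ n * (2 * k) := mul_le_mul_of_nonneg_left hsk (Nat.cast_nonneg n)
        _ = 2 * n * k := by ring
    exact_mod_cast this


/-- The Green kernel of a ball is comparable to a constant on a sphere. -/
theorem Harnack.gb_sphere {p H : ℝ} (hp : W.Elliptic p) (hH : W.Harnack H) {x a b : V} {R : ℝ}
    (hR : 1 / 2 < R) (ha : W.graph.dist x a = ⌈R⌉₊) (hb : W.graph.dist x b = ⌈R⌉₊) :
    (p / H) ^ 48 * W.gb x (2 * R) a ≤ W.gb x (2 * R) b := by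
  have hR0 : 0 < R := by linarith
  have hH0 : 0 < H := zero_lt_one.trans_le hH.one_le
  have hq : 0 ≤ p / H := (div_pos hp.pos hH0).le
  set n := ⌈R⌉₊
  have hn0 : 0 < n := Nat.ceil_pos.2 hR0
  have hRn : (n : ℝ) < R + 1 := Nat.ceil_lt_add_one hR0.le
  have hnR : (n : ℝ) < 2 * R := by
    rcases le_or_gt R 1 with h | h
    · have : n ≤ 1 := Nat.ceil_le.2 (by simpa using h)
      have : (n : ℝ) ≤ 1 := by exact_mod_cast this
      linarith
    · linarith
  have hn' : (0 : ℝ) < n := by exact_mod_cast hn0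
  -- Harnack needs harmonicity on balls of radius 2s along the chain. This is n/6 when n ≥ 6;
  -- otherwise it is 1 and the balls are single vertices.
  set s := max ((n : ℝ) / 12) (1 / 2) with hs
  have hs0 : 0 < s := lt_max_of_lt_right (by norm_num)
  have hsn : (n : ℝ) ≤ 12 * s := by have := le_max_left ((n : ℝ) / 12) (1 / 2); linarith
  simp only [gb]
  set A := W.fball x (2 * R) with hA
  have ha' : (W.graph.dist x a : ℝ) = n := by rw [ha]
  have hb' : (W.graph.dist x b : ℝ) = n := by rw [hb]
  -- An annulus need not be connected, so a chain around x may not exist. If a and b are far apart,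
  -- the pole is moved instead: g(a,x) is compared with g(a,b) along a geodesic from x to b avoiding
  -- a, then g(b,a) with g(b,x) along a geodesic from a to x avoiding b. Symmetry of g links the
  -- two.
  rcases le_or_gt ((n : ℝ) / 3) (W.graph.dist a b) with hab | hab
  · have c1 := hH.chain hp (u := W.gr A a) (a := x) (b := b) (n := 12)
      (fun z => W.gr_nonneg _ _ _) hs0 (by rw [hb]; exact_mod_cast hsn) (fun z hz w hw => by
        obtain ⟨h1, h2⟩ := near_geodesic hnR hRn hn0 ha hb hab (hb ▸ hz) hw
        exact W.lap_gr_of_ne (by rw [hA, mem_fball]; exact h1) h2)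
    have c2 := hH.chain hp (u := W.gr A b) (a := a) (b := x) (n := 12)
      (fun z => W.gr_nonneg _ _ _) hs0
      (by rw [SimpleGraph.dist_comm, ha]; exact_mod_cast hsn) (fun z hz w hw => by
        have hz' : W.graph.dist x z + W.graph.dist z a = n := by
          rw [← ha, SimpleGraph.dist_comm (u := x) (v := z), SimpleGraph.dist_comm (u := x) (v := a),
            SimpleGraph.dist_comm (u := z) (v := a)]
          omega
        obtain ⟨h1, h2⟩ := near_geodesic hnR hRn hn0 hb ha
          (by rw [SimpleGraph.dist_comm]; exact hab) hz' hw
        exact W.lap_gr_of_ne (by rw [hA, mem_fball]; exact h1) h2)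
    rw [W.gr_symm A x a, W.gr_symm A x b]
    rw [W.gr_symm A b a] at c2
    calc (p / H) ^ 48 * W.gr A a x = (p / H) ^ (2 * 12) * ((p / H) ^ (2 * 12) * W.gr A a x) := by
          ring
      _ ≤ (p / H) ^ (2 * 12) * W.gr A a b := mul_le_mul_of_nonneg_left c1 (by positivity)
      _ ≤ W.gr A b x := c2
  -- Here d(a,b) < n/3, so each point of a geodesic from a to b is within n/6 of an endpoint, and
  -- the chain of balls avoids the pole x. The count 24 matches the loss of the other case.
  · refine hH.chain hp (u := W.gr A x) (a := a) (b := b) (n := 24)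
      (fun z => W.gr_nonneg _ _ _) hs0 (by push_cast; linarith) (fun z hz w hw => ?_)
    have hzr : (W.graph.dist a z : ℝ) + W.graph.dist z b = W.graph.dist a b := by
      exact_mod_cast hz
    have t1 := W.dist_triangle_real x z w
    have t2 := W.dist_triangle_real x a z
    have t3 := W.dist_triangle_real x b z
    have t4 := W.dist_comm_real b z
    have t5 := W.dist_triangle_real x z a
    have t6 := W.dist_triangle_real x z b
    have t7 := W.dist_comm_real a z
    have t8 := W.dist_triangle_real x w z
    have t9 := W.dist_comm_real w z
    have key : (W.graph.dist x w : ℝ) < 2 * R ∧ (0 : ℝ) < W.graph.dist x w := by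
      by_cases h6 : n < 6
      · have h6' : (n : ℝ) ≤ 5 := by exact_mod_cast (by omega)
        rw [hs, max_eq_right (by linarith)] at hw
        have hzw : z = w := by
          have : (W.graph.dist z w : ℝ) < (1 : ℕ) := by push_cast; linarith
          have := Nat.cast_lt.1 this
          exact W.connected.dist_eq_zero_iff.1 (by omega)
        subst hzw
        have hab1 : W.graph.dist a b ≤ 1 := by
          have : (W.graph.dist a b : ℝ) < (2 : ℕ) := by push_cast; linarith
          have := Nat.cast_lt.1 this
          omega
        rcases (show W.graph.dist a z = 0 ∨ W.graph.dist z b = 0 by omega) with h | h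
        · obtain rfl := W.connected.dist_eq_zero_iff.1 h
          rw [ha']; exact ⟨hnR, hn'⟩
        · obtain rfl := W.connected.dist_eq_zero_iff.1 h
          rw [hb']; exact ⟨hnR, hn'⟩
      · have h6' : (6 : ℝ) ≤ n := by exact_mod_cast (by omega)
        rw [hs, max_eq_left (by linarith)] at hw
        rcases le_total (W.graph.dist a z : ℝ) (W.graph.dist z b) with h | h
        · exact ⟨by linarith, by linarith⟩
        · exact ⟨by linarith, by linarith⟩
    refine W.lap_gr_of_ne (by rw [hA, mem_fball]; exact key.1) ?_
    rintro rfl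
    simp at key

theorem Elliptic.gb_pos {p : ℝ} (hp : W.Elliptic p) {x y : V} {R : ℝ}
    (h : (W.graph.dist x y : ℝ) < R) : 0 < W.gb x R y := by
  obtain ⟨γ, h0, h1, hadj, hd⟩ := W.exists_geodesic x y
  have hR : 0 < R := lt_of_le_of_lt (Nat.cast_nonneg _) h
  have key : ∀ i ≤ W.graph.dist x y, 0 < W.gb x R (γ i) := by
    intro i
    induction i with
    | zero =>
      intro _
      rw [h0]
      have := W.mass_mul_gb_self_ge_one x hR
      exact pos_of_mul_pos_left (by linarith) (W.mass_nonneg x)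
    | succ i ih =>
      intro hi
      have hmem : γ (i + 1) ∈ W.fball x R := by
        have e := hd 0 (i + 1) (Nat.zero_le _) hi
        rw [h0] at e
        rw [mem_fball, e]
        refine lt_of_le_of_lt ?_ h
        exact_mod_cast hi
      exact (mul_pos hp.pos (ih (by omega))).trans_le
        (hp.mul_le (W.lap_gr_nonpos x hmem) (fun _ _ => W.gr_nonneg _ _ _) (hadj i (by omega)).symm)
  rw [← h1]
  exact key _ le_rfl

/-- A bound of the Green kernel on a sphere extends to the outside of the sphere. -/
theorem gb_le_of_sphere {x : V} {n : ℕ} {R M : ℝ} (hM : 0 ≤ M)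
    (h : ∀ a, W.graph.dist x a = n → W.gb x R a ≤ M) {y : V} (hy : n ≤ W.graph.dist x y) :
    W.gb x R y ≤ M := by
  rcases hy.eq_or_lt with hy | hy
  · exact h y hy.symm
  rcases le_or_gt R (W.graph.dist x y) with hyR | hyR
  · rw [W.gb_eq_zero hyR]; exact hM
  refine W.le_of_lap_le (A := (W.fball x R).filter fun z => n < W.graph.dist x z) (u := W.gb x R)
    (v := fun _ => M) (fun z hz => ?_) (fun z hz w hzw hw => ?_) y ?_
  · rw [Finset.mem_filter] at hz
    rw [lap_const]
    exact (W.lap_gr_of_ne hz.1 (by rintro rfl; simp at hz)).ge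
  · rw [Finset.mem_filter] at hz hw
    rcases le_or_gt R (W.graph.dist x w) with hwR | hwR
    · rw [W.gb_eq_zero hwR]; exact hM
    · have h1 := W.dist_le_add_one (x := x) hzw.symm
      refine h w ?_
      have h2 : ¬ n < W.graph.dist x w := fun h => hw ⟨by rw [mem_fball]; exact hwR, h⟩
      omega
  · rw [Finset.mem_filter, mem_fball]; exact ⟨hyR, hy⟩

/-- A lower bound of the Green kernel on a sphere extends to the inside of the sphere. -/
theorem le_gb_of_sphere {x : V} {R m : ℝ} (hR : 0 < R)
    (h : ∀ a, W.graph.dist x a = ⌈R⌉₊ → m ≤ W.gb x (2 * R) a) {y : V}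
    (hy : (W.graph.dist x y : ℝ) < R) : m ≤ W.gb x (2 * R) y := by
  refine W.le_of_lap_le (A := W.fball x R) (u := fun _ => m) (v := W.gb x (2 * R))
    (fun z hz => ?_) (fun z hz w hzw hw => ?_) y (by rw [mem_fball]; exact hy)
  · rw [lap_const]
    exact W.lap_gr_nonpos x (W.fball_mono x (by linarith) hz)
  · rw [mem_fball] at hz hw
    refine h w (le_antisymm ?_ (Nat.ceil_le.2 (not_lt.1 hw)))
    have h1 := W.dist_le_add_one (x := x) hzw
    have h2 := Nat.lt_ceil.2 hz
    omega

/-- Both balls reduce to the centre. This settles (g) for the radii on which (ER) is silent. -/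
theorem gscale_eq_of_le {x : V} {R : ℝ} (hR : 0 < R) (hR2 : R ≤ 1 / 2) :
    W.gscale x R = W.gb x (2 * R) x := by
  have hb : ∀ r : ℝ, 0 < r → r ≤ 1 → W.fball x r = {x} := by
    intro r h0 h1
    ext y
    rw [mem_fball, Finset.mem_singleton]
    constructor
    · intro h
      have : (W.graph.dist x y : ℝ) < (1 : ℕ) := by push_cast; linarith
      have := Nat.cast_lt.1 this
      exact (W.connected.dist_eq_zero_iff.1 (by omega)).symm
    · rintro rfl; simpa using h0
  rw [gscale, exitR, volR, hb R hR (by linarith), hb (2 * R) (by linarith) (by linarith),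
    Finset.sum_singleton, Finset.sum_singleton, mul_div_cancel_right₀ _ (W.mass_pos x).ne']

variable [Countable V] [MeasurableSpace V] [DiscreteMeasurableSpace V]

/-- Only the upper half of (ER) is needed: the annulus volume is at most V(x,2R), and doubling turns
this into V(x,R). -/
theorem EinsteinRelation.exitR_le (h : W.EinsteinRelation) {D : ℝ} (hD : W.Doubling D) :
    ∃ C : ℝ, 0 < C ∧ ∀ (x : V) (R K : ℝ), 1 / 2 < R → 0 ≤ K →
      W.annulusResistance x R (2 * R) ≤ ENNReal.ofReal K → W.gscale x R ≤ C * K := by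
  obtain ⟨C, hC, h⟩ := h
  have hD0 : 0 < D := zero_lt_one.trans_le hD.one_le
  refine ⟨C * D, mul_pos hC hD0, fun x R K hR hK hρ => ?_⟩
  have hR0 : 0 < R := by linarith
  have h1 := (h x R hR).1
  have h2 : W.annulusVol x R (2 * R) ≤ ENNReal.ofReal (W.volR x (2 * R)) := by
    rw [← vol_eq_ofReal]; exact tsub_le_self
  have h3 : W.meanExit x (2 * R)
      ≤ ENNReal.ofReal (C * (K * W.volR x (2 * R))) := by
    rw [ENNReal.ofReal_mul (NNReal.coe_nonneg C), ENNReal.ofReal_mul hK, ENNReal.ofReal_coe_nnreal]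
    exact h1.trans (mul_le_mul_right (mul_le_mul' hρ h2) _)
  rw [meanExit_eq_ofReal, ENNReal.ofReal_le_ofReal_iff
    (mul_nonneg (NNReal.coe_nonneg C) (mul_nonneg hK (W.volR_nonneg _ _)))] at h3
  rw [gscale, div_le_iff₀ (W.volR_pos x hR0)]
  calc W.exitR x (2 * R) ≤ C * (K * W.volR x (2 * R)) := h3
    _ ≤ C * (K * (D * W.volR x R)) := by
        have := hD.le_mul x R hR0
        gcongr
    _ = C * D * K * W.volR x R := by ring

theorem greenKernelBounds_of_harnack_of_einstein {p D : ℝ} (hp : W.Elliptic p) (hD : W.Doubling D)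
    (hH : W.EllipticHarnack) (hE : W.EinsteinRelation) : W.GreenKernelBounds := by
  obtain ⟨H, hH⟩ := hH.exists_harnack
  obtain ⟨C, hC, hE⟩ := hE.exitR_le hD
  have hp0 := hp.pos
  have hH0 : 0 < H := zero_lt_one.trans_le hH.one_le
  obtain ⟨Q, hQ⟩ : ∃ Q, Q = (p / H) ^ 48 := ⟨_, rfl⟩
  have hQ0 : 0 < Q := by rw [hQ]; positivity
  rw [greenKernelBounds_iff]
  refine ⟨(Q * Q)⁻¹, min 1 (Q * (Q * p / C)), by positivity, by positivity, fun x R hR => ?_⟩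
  rcases le_or_gt R (1 / 2) with hR2 | hR2
  · refine ⟨fun y hy => ?_, fun y hy => ?_⟩
    · rw [W.gb_eq_zero]
      · have := W.gscale_pos x hR; positivity
      · have : 0 < W.graph.dist x y := by
          have : (0 : ℝ) < W.graph.dist x y := by linarith
          exact_mod_cast this
        have : (1 : ℝ) ≤ W.graph.dist x y := by exact_mod_cast this
        linarith
    · have : (W.graph.dist x y : ℝ) < (1 : ℕ) := by push_cast; linarith
      have := Nat.cast_lt.1 this
      obtain rfl := W.connected.dist_eq_zero_iff.1 (show W.graph.dist x y = 0 by omega)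
      rw [gscale_eq_of_le hR hR2]
      exact mul_le_of_le_one_left (W.gb_nonneg _ _ _) (min_le_left _ _)
  · obtain ⟨b, hb⟩ := W.exists_dist_eq x ⌈R⌉₊
    have hbR : (W.graph.dist x b : ℝ) < 2 * R := by
      rw [hb]
      rcases le_or_gt R 1 with h | h
      · have : ⌈R⌉₊ ≤ 1 := Nat.ceil_le.2 (by simpa using h)
        have : (⌈R⌉₊ : ℝ) ≤ 1 := by exact_mod_cast this
        linarith
      · have := Nat.ceil_lt_add_one hR.le
        linarith
    set t := W.gb x (2 * R) b with ht
    have ht0 : 0 < t := hp.gb_pos hbR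
    have hup : ∀ y, R ≤ W.graph.dist x y → W.gb x (2 * R) y ≤ Q⁻¹ * t := fun y hy =>
      gb_le_of_sphere (by positivity) (fun a ha => by
        have := hH.gb_sphere hp hR2 ha hb
        rw [← hQ] at this
        rw [inv_mul_eq_div, le_div_iff₀ hQ0]
        linarith) (Nat.ceil_le.2 hy)
    have hlow : ∀ y, (W.graph.dist x y : ℝ) < R → Q * t ≤ W.gb x (2 * R) y := fun y hy =>
      le_gb_of_sphere hR (fun a ha => by rw [hQ]; exact hH.gb_sphere hp hR2 hb ha) hy
    have hvol := W.volR_pos x hR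
    -- Integrating the lower bound over B(x,R) bounds t by a multiple of F(x,R), which yields the
    -- upper half of (g) without (ER). The next estimate bounds F(x,R) by t through the resistance,
    -- which yields the lower half.
    have h1 : Q * t ≤ W.gscale x R := by
      rw [gscale, le_div_iff₀ hvol]; exact mul_volR_le_exitR hR hlow
    have h2 := hE x R (Q⁻¹ * t / p) hR2 (by positivity)
      (W.annulusResistance_le hp hR2 (by positivity) hup)
    refine ⟨fun y hy => (hup y hy).trans ?_, fun y hy => le_trans ?_ (hlow y hy)⟩
    · have : t ≤ Q⁻¹ * W.gscale x R := by
        rw [inv_mul_eq_div, le_div_iff₀ hQ0]; linarith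
      calc Q⁻¹ * t ≤ Q⁻¹ * (Q⁻¹ * W.gscale x R) := by gcongr
        _ = (Q * Q)⁻¹ * W.gscale x R := by rw [mul_inv]; ring
    · have hg := W.gscale_pos x hR
      calc min 1 (Q * (Q * p / C)) * W.gscale x R
          ≤ Q * (Q * p / C) * W.gscale x R := by
            exact mul_le_mul_of_nonneg_right (min_le_right _ _) hg.le
        _ ≤ Q * (Q * p / C) * (C * (Q⁻¹ * t / p)) := by gcongr
        _ = Q * t := by field_simp

end

end WeightedGraph

namespace WeightedGraph

noncomputable section

open scoped Classical

variable {V : Type*} {W : WeightedGraph V} [W.LocFinite] [Infinite V]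

/-! ### From the Green kernel to the Einstein relation -/

variable (W) in
/-- The two-sided bounds of the Green kernel with constants `C` and `c`. -/
structure GreenBounds (C c : ℝ) : Prop where
  one_le : 1 ≤ C
  pos : 0 < c
  le_one : c ≤ 1
  upper : ∀ (x : V) (R : ℝ), 0 < R → ∀ y, R ≤ W.graph.dist x y →
    W.gb x (2 * R) y ≤ C * W.gscale x R
  lower : ∀ (x : V) (R : ℝ), 0 < R → ∀ y, (W.graph.dist x y : ℝ) < R →
    c * W.gscale x R ≤ W.gb x (2 * R) y

/-- An annulus contains a vertex together with a ball of comparable radius. -/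
theorem Doubling.volR_le_annulus {D : ℝ} (hD : W.Doubling D) (x : V) {R : ℝ} (hR : 1 / 2 < R) :
    W.volR x R ≤ D ^ 5 * (W.volR x (2 * R) - W.volR x R) := by
  have hR0 : 0 < R := by linarith
  -- The annulus is to contain B(y,R/8) with d(x,y) = k. For R < 8 that ball is the single vertex y
  -- and R ≤ k < 2R suffices; otherwise a margin of R/8 is kept on both sides.
  obtain ⟨k, hk1, hk2, hk3⟩ : ∃ k : ℕ, R ≤ k ∧ (k : ℝ) < 2 * R ∧
      (R < 8 ∨ 9 * R / 8 ≤ k ∧ (k : ℝ) ≤ 15 * R / 8) := by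
    rcases lt_or_ge R 8 with h | h
    · refine ⟨⌈R⌉₊, Nat.le_ceil R, ?_, Or.inl h⟩
      rcases le_or_gt R 1 with h | h
      · have : ⌈R⌉₊ ≤ 1 := Nat.ceil_le.2 (by simpa using h)
        have : (⌈R⌉₊ : ℝ) ≤ 1 := by exact_mod_cast this
        linarith
      · have := Nat.ceil_lt_add_one hR0.le
        linarith
    · have h1 := Nat.le_ceil (9 * R / 8)
      have h2 := Nat.ceil_lt_add_one (show 0 ≤ 9 * R / 8 by positivity)
      exact ⟨⌈9 * R / 8⌉₊, by linarith, by linarith, Or.inr ⟨h1, by linarith⟩⟩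
  obtain ⟨y, hy⟩ := W.exists_dist_eq x k
  have hyr : (W.graph.dist x y : ℝ) = k := by rw [hy]
  have hsub : ∀ z ∈ W.fball y (R / 8), R ≤ W.graph.dist x z ∧ (W.graph.dist x z : ℝ) < 2 * R := by
    intro z hz
    rw [mem_fball] at hz
    rcases hk3 with h | ⟨h1, h2⟩
    · have : (W.graph.dist y z : ℝ) < (1 : ℕ) := by push_cast; linarith
      have := Nat.cast_lt.1 this
      obtain rfl := W.connected.dist_eq_zero_iff.1 (show W.graph.dist y z = 0 by omega)
      rw [hyr]; exact ⟨hk1, hk2⟩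
    · have t1 := W.dist_triangle_real x y z
      have t2 := W.dist_triangle_real x z y
      have t3 := W.dist_comm_real y z
      exact ⟨by linarith, by linarith⟩
  have hdisj : Disjoint (W.fball x R) (W.fball y (R / 8)) :=
    Finset.disjoint_right.2 fun z hz hzx => by
      rw [mem_fball] at hzx
      linarith [(hsub z hz).1]
  have hadd : W.volR x R + W.volR y (R / 8) ≤ W.volR x (2 * R) := by
    rw [volR, volR, ← Finset.sum_union hdisj]
    refine Finset.sum_le_sum_of_subset_of_nonneg (Finset.union_subset
      (W.fball_mono x (by linarith)) fun z hz => ?_) fun _ _ _ => W.mass_nonneg _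
    rw [mem_fball]; exact (hsub z hz).2
  -- Since d(x,y) < 2R, the ball B(x,R) lies in B(y,4R), and 4R is 2⁵ times R/8.
  have h1 : W.volR x R ≤ W.volR y (2 ^ 5 * (R / 8)) := W.volR_mono_subset (W.fball_subset (by
    rw [dist_comm_real, hyr]; linarith))
  have h2 := hD.le_pow_mul y (show 0 < R / 8 by positivity) 5
  have h3 : 0 ≤ D ^ 5 := pow_nonneg (zero_le_one.trans hD.one_le) 5
  calc W.volR x R ≤ D ^ 5 * W.volR y (R / 8) := h1.trans h2
    _ ≤ D ^ 5 * (W.volR x (2 * R) - W.volR x R) :=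
      mul_le_mul_of_nonneg_left (by linarith) h3

/-- Here E = F·V(x,R), the resistance lies between cF and CF/p, and the volume of the annulus is
comparable to V(x,R). -/
theorem GreenBounds.einsteinRelation [Countable V] [MeasurableSpace V] [DiscreteMeasurableSpace V]
    {p D C c : ℝ} (hp : W.Elliptic p) (hD : W.Doubling D) (hg : W.GreenBounds C c) :
    W.EinsteinRelation := by
  have hp0 := hp.pos
  have hc0 := hg.pos
  have hC0 : 0 < C := zero_lt_one.trans_le hg.one_le
  have hD0 : 0 < D := zero_lt_one.trans_le hD.one_le
  obtain ⟨K, hK⟩ : ∃ K, K = D ^ 5 / c + C * D / p := ⟨_, rfl⟩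
  have hK0 : 0 < K := by rw [hK]; positivity
  refine ⟨K.toNNReal, Real.toNNReal_pos.2 hK0, fun x R hR => ?_⟩
  have hR0 : 0 < R := by linarith
  have hs := W.gscale_pos x hR0
  have hV := W.volR_pos x hR0
  have hE : W.exitR x (2 * R) = W.gscale x R * W.volR x R := by
    rw [gscale, div_mul_cancel₀ _ hV.ne']
  have hann : W.annulusVol x R (2 * R) = ENNReal.ofReal (W.volR x (2 * R) - W.volR x R) := by
    rw [annulusVol, vol_eq_ofReal, vol_eq_ofReal, ENNReal.ofReal_sub _ hV.le]
  have hv := hD.volR_le_annulus x hR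
  have hv2 := hD.le_mul x R hR0
  have hvpos : 0 ≤ W.volR x (2 * R) - W.volR x R :=
    sub_nonneg.2 (W.volR_mono_subset (W.fball_mono x (by linarith)))
  have hKe : (K.toNNReal : ℝ≥0∞) = ENNReal.ofReal K := rfl
  have hlow := W.le_annulusResistance hR0 (mul_pos hc0 hs) (hg.lower x R hR0)
  have hup := W.annulusResistance_le hp hR (mul_pos hC0 hs) (hg.upper x R hR0)
  rw [hKe, hann, meanExit_eq_ofReal]
  constructor
  · refine le_trans ?_ (mul_le_mul_right (mul_le_mul_left hlow _) _)
    rw [← ENNReal.ofReal_mul (by positivity), ← ENNReal.ofReal_mul hK0.le]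
    refine ENNReal.ofReal_le_ofReal ?_
    calc W.exitR x (2 * R) ≤ W.gscale x R * (D ^ 5 * (W.volR x (2 * R) - W.volR x R)) := by
          rw [hE]; exact mul_le_mul_of_nonneg_left hv hs.le
      _ = D ^ 5 / c * (c * W.gscale x R * (W.volR x (2 * R) - W.volR x R)) := by field_simp
      _ ≤ K * (c * W.gscale x R * (W.volR x (2 * R) - W.volR x R)) := by
          refine mul_le_mul_of_nonneg_right ?_ (by positivity)
          rw [hK]; exact le_add_of_nonneg_right (by positivity)
  · refine (mul_le_mul_left hup _).trans ?_
    rw [← ENNReal.ofReal_mul (by positivity), ← ENNReal.ofReal_mul hK0.le]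
    refine ENNReal.ofReal_le_ofReal ?_
    calc C * W.gscale x R / p * (W.volR x (2 * R) - W.volR x R)
        ≤ C * W.gscale x R / p * (D * W.volR x R) := by
          refine mul_le_mul_of_nonneg_left ?_ (by positivity)
          linarith
      _ = C * D / p * W.exitR x (2 * R) := by rw [hE]; ring
      _ ≤ K * W.exitR x (2 * R) := by
          refine mul_le_mul_of_nonneg_right ?_ (W.exitR_nonneg _ _)
          rw [hK]; exact le_add_of_nonneg_left (by positivity)

theorem GreenKernelBounds.exists_greenBounds [Countable V] [MeasurableSpace V]
    [DiscreteMeasurableSpace V] (h : W.GreenKernelBounds) : ∃ C c, W.GreenBounds C c := by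
  obtain ⟨C, c, hC, hc, h⟩ := W.greenKernelBounds_iff.1 h
  refine ⟨max C 1, min c 1, le_max_right _ _, lt_min hc one_pos, min_le_right _ _,
    fun x R hR y hy => ((h x R hR).1 y hy).trans ?_, fun x R hR y hy => le_trans ?_ ((h x R hR).2 y hy)⟩
  · exact mul_le_mul_of_nonneg_right (le_max_left _ _) (W.gscale_pos x hR).le
  · exact mul_le_mul_of_nonneg_right (min_le_left _ _) (W.gscale_pos x hR).le

end

end WeightedGraph

namespace WeightedGraph

noncomputable section

open scoped Classical

variable {V : Type*} {W : WeightedGraph V} [W.LocFinite]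

/-! ### From the Green kernel to the Harnack inequality -/

/-- Together with `lap_add_potential`: adding to f the Green potential of its Laplacian gives the
harmonic extension into A of the values of f off A. -/
theorem add_potential_eq (A : Finset V) (f : V → ℝ) {x : V} (hx : x ∉ A) :
    f x + ∑ z ∈ A, W.gr A x z * W.lap f z = f x := by
  rw [Finset.sum_eq_zero fun z _ => by rw [W.gr_left_eq_zero hx, zero_mul], add_zero]

variable [Infinite V]

/-- This is the easy direction: E grows with the radius and V grows at most by D. The reverse
control of F is `GreenBounds.exists_gscale_le`. -/
theorem Doubling.gscale_le {D : ℝ} (hD : W.Doubling D) (y : V) {r s : ℝ} (hr : 0 < r) (hrs : r ≤ s)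
    (hsr : s ≤ 2 * r) : W.gscale y r ≤ D * W.gscale y s := by
  have hv := W.volR_pos y hr
  have hv' := W.volR_pos y (hr.trans_le hrs)
  have h1 : W.volR y s ≤ D * W.volR y r :=
    (W.volR_mono_subset (W.fball_mono y hsr)).trans (hD.le_mul y r hr)
  have h2 := W.exitR_mono y (show 2 * r ≤ 2 * s by linarith)
  rw [gscale, gscale, div_le_iff₀ hv, mul_div_assoc', div_mul_eq_mul_div, le_div_iff₀ hv']
  calc W.exitR y (2 * r) * W.volR y s ≤ W.exitR y (2 * s) * (D * W.volR y r) :=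
        mul_le_mul h2 h1 hv'.le (W.exitR_nonneg _ _)
    _ = D * W.exitR y (2 * s) * W.volR y r := by ring

/-- Enlarging the domain adds at most the maximum of the new Green kernel off the old domain. -/
theorem gb_le_add {y : V} {r s M : ℝ} (hrs : r ≤ s)
    (h : ∀ w, r ≤ W.graph.dist y w → W.gb y s w ≤ M) (w : V) : W.gb y s w ≤ W.gb y r w + M := by
  rcases le_or_gt r (W.graph.dist y w) with hw | hw
  · linarith [h w hw, W.gb_nonneg y r w]
  refine W.le_of_lap_le (A := W.fball y r) (u := W.gb y s) (v := fun z => W.gb y r z + M)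
    (fun z hz => ?_) (fun z _ v _ hv => ?_) w (W.mem_fball.2 hw)
  · rw [W.lap_add (W.gb y r) (fun _ => M), lap_const, add_zero, gb_def, gb_def, W.lap_gr y hz,
      W.lap_gr y (W.fball_mono y hrs hz)]
  · rw [mem_fball, not_lt] at hv
    linarith [h v hv, W.gb_nonneg y r v]

/-- The domain is enlarged dyadically, each enlargement adding at most the upper bound of (g) at the
new scale. The factor D moves the earlier terms to the new scale, and the factor 2 absorbs the added
one. -/
theorem GreenBounds.gb_le {D C c : ℝ} (hD : W.Doubling D) (hg : W.GreenBounds C c) (y : V) {r : ℝ}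
    (hr : 0 < r) (k : ℕ) {w : V} (hw : r ≤ W.graph.dist y w) :
    W.gb y (2 * (2 ^ k * r)) w ≤ C * (2 * D) ^ k * W.gscale y (2 ^ k * r) := by
  have hC0 : 0 < C := zero_lt_one.trans_le hg.one_le
  have hD1 := hD.one_le
  induction k with
  | zero => simpa using hg.upper y r hr w hw
  | succ k ih =>
    set s := 2 ^ k * r with hs
    have hs0 : 0 < s := by positivity
    have e : 2 ^ (k + 1) * r = 2 * s := by rw [hs]; ring
    rw [e]
    have hF := W.gscale_pos y (show 0 < 2 * s by positivity)
    have h1 := gb_le_add (y := y) (r := 2 * s) (s := 2 * (2 * s)) (by linarith)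
      (fun v hv => hg.upper y (2 * s) (by positivity) v hv) w
    have h2 := hD.gscale_le y hs0 (show s ≤ 2 * s by linarith) le_rfl
    have h3 : 1 ≤ (2 * D) ^ k := one_le_pow₀ (by linarith)
    have h4 : C * W.gscale y (2 * s) ≤ C * (2 * D) ^ k * D * W.gscale y (2 * s) := by
      refine mul_le_mul_of_nonneg_right ?_ hF.le
      rw [mul_assoc]
      exact le_mul_of_one_le_right hC0.le (one_le_mul_of_one_le_of_one_le h3 hD1)
    calc W.gb y (2 * (2 * s)) w
        ≤ C * (2 * D) ^ k * W.gscale y s + C * W.gscale y (2 * s) := by linarith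
      _ ≤ C * (2 * D) ^ k * (D * W.gscale y (2 * s))
          + C * (2 * D) ^ k * D * W.gscale y (2 * s) := by
          gcongr
      _ = C * (2 * D) ^ (k + 1) * W.gscale y (2 * s) := by ring

/-- A nonnegative superharmonic function that is at least `α` on a ball is at least a multiple of
`α` on the ball of twice the radius. -/
theorem GreenBounds.superharmonic_double {p D C c : ℝ} (hp : W.Elliptic p) (hD : W.Doubling D)
    (hg : W.GreenBounds C c) {y : V} {r α : ℝ} (hr : 0 < r) (hα : 0 ≤ α) {s : V → ℝ}
    (hnn : ∀ z, 0 ≤ s z) (hs : ∀ z, (W.graph.dist y z : ℝ) < 4 * r → W.lap s z ≤ 0)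
    (h : ∀ z, (W.graph.dist y z : ℝ) < r → α ≤ s z) {z : V}
    (hz : (W.graph.dist y z : ℝ) < 2 * r) : c * p / (2 * C * D) * α ≤ s z := by
  have hC0 : 0 < C := zero_lt_one.trans_le hg.one_le
  have hD0 : 0 < D := zero_lt_one.trans_le hD.one_le
  have hp0 := hp.pos
  have hc0 := hg.pos
  have hF := W.gscale_pos y (show 0 < 2 * r by positivity)
  -- The kernel g of B(y,4r) is at most pN off B(y,r), hence at most N at the vertices of B(y,r)
  -- adjacent to the outside. So αg/N lies below s on the boundary of the region r ≤ d(y,·) < 4r,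
  -- and (g) at scale 2r bounds it below on B(y,2r).
  obtain ⟨N, hN⟩ : ∃ N, N = 2 * C * D * W.gscale y (2 * r) / p := ⟨_, rfl⟩
  have hN0 : 0 < N := by rw [hN]; positivity
  have hup : ∀ w, r ≤ W.graph.dist y w → W.gb y (4 * r) w ≤ p * N := fun w hw => by
    have := hg.gb_le hD y hr 1 hw
    rw [pow_one, pow_one, show 2 * (2 * r) = 4 * r by ring] at this
    calc _ ≤ _ := this
      _ = p * N := by rw [hN]; field_simp
  have hle1 : c * p / (2 * C * D) ≤ 1 := by
    rw [div_le_one (by positivity)]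
    have : c * p ≤ 1 := mul_le_one₀ hg.le_one hp0.le hp.le_one
    have : 1 ≤ C * D := one_le_mul_of_one_le_of_one_le hg.one_le hD.one_le
    linarith
  rcases lt_or_ge (W.graph.dist y z : ℝ) r with hzr | hzr
  · exact (mul_le_of_le_one_left hα hle1).trans (h z hzr)
  have key := W.le_of_lap_le (A := (W.fball y (4 * r)).filter fun z => r ≤ W.graph.dist y z)
    (u := fun w => α / N * W.gb y (4 * r) w) (v := s) (fun w hw => ?_) (fun w hw v hwv hv => ?_) z ?_
  · have hlow := hg.lower y (2 * r) (by positivity) z hz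
    rw [show 2 * (2 * r) = 4 * r by ring] at hlow
    calc c * p / (2 * C * D) * α = α / N * (c * W.gscale y (2 * r)) := by rw [hN]; field_simp
      _ ≤ α / N * W.gb y (4 * r) z := mul_le_mul_of_nonneg_left hlow (by positivity)
      _ ≤ s z := key
  · rw [Finset.mem_filter] at hw
    rw [lap_const_mul, gb_def, W.lap_gr_of_ne hw.1, mul_zero]
    · exact hs w (W.mem_fball.1 hw.1)
    · rintro rfl; simp at hw; linarith
  · rw [Finset.mem_filter] at hw hv
    rcases le_or_gt (4 * r) (W.graph.dist y v) with hv4 | hv4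
    · rw [W.gb_eq_zero hv4, mul_zero]; exact hnn v
    · have hvr : (W.graph.dist y v : ℝ) < r := not_le.1 fun hc => hv ⟨W.mem_fball.2 hv4, hc⟩
      have hwy : w ≠ y := by rintro rfl; simp at hw; linarith
      have h1 := hp.mul_le (u := W.gb y (4 * r)) (W.lap_gr_of_ne hw.1 hwy).le
        (fun _ _ => W.gb_nonneg _ _ _) hwv
      have h2 : W.gb y (4 * r) v ≤ N := le_of_mul_le_mul_left (h1.trans (hup w hw.2)) hp0
      calc α / N * W.gb y (4 * r) v ≤ α / N * N := mul_le_mul_of_nonneg_left h2 (by positivity)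
        _ = α := by field_simp
        _ ≤ s v := h v hvr
  · rw [Finset.mem_filter, mem_fball]; exact ⟨by linarith, hzr⟩

/-- Propagation of a lower bound of a superharmonic function along a geodesic. -/
theorem GreenBounds.chain {p D C c : ℝ} (hp : W.Elliptic p) (hD : W.Doubling D)
    (hg : W.GreenBounds C c) {a b : V} {r α : ℝ} {N : ℕ} (hr : 0 < r) (hα : 0 ≤ α) {s : V → ℝ}
    (hnn : ∀ z, 0 ≤ s z) (hN : W.graph.dist a b ≤ N * r)
    (hs : ∀ z, W.graph.dist a z + W.graph.dist z b = W.graph.dist a b →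
      ∀ w, (W.graph.dist z w : ℝ) < 4 * r → W.lap s w ≤ 0)
    (h : ∀ w, (W.graph.dist a w : ℝ) < r → α ≤ s w) :
    ∀ w, (W.graph.dist b w : ℝ) < r → (c * p / (2 * C * D)) ^ (2 * N) * α ≤ s w := by
  have hC0 : 0 < C := zero_lt_one.trans_le hg.one_le
  have hD0 : 0 < D := zero_lt_one.trans_le hD.one_le
  have hp0 := hp.pos
  have hc0 := hg.pos
  obtain ⟨q, hq⟩ : ∃ q, q = c * p / (2 * C * D) := ⟨_, rfl⟩
  have hq0 : 0 ≤ q := by rw [hq]; positivity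
  have hqp : q ≤ p := by
    rw [hq, div_le_iff₀ (by positivity)]
    have h1 : 1 ≤ C * D := one_le_mul_of_one_le_of_one_le hg.one_le hD.one_le
    have h2 : c * p ≤ 1 * p := mul_le_mul_of_nonneg_right hg.le_one hp0.le
    nlinarith
  have hq1 : q ≤ 1 := hqp.trans hp.le_one
  obtain ⟨γ, h0, h1, hadj, hd⟩ := W.exists_geodesic a b
  have hgeo : ∀ j ≤ W.graph.dist a b,
      W.graph.dist a (γ j) + W.graph.dist (γ j) b = W.graph.dist a b := by
    intro j hj
    have e1 := hd 0 j (Nat.zero_le _) hj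
    have e2 := hd j _ hj le_rfl
    rw [h0] at e1
    rw [h1] at e2
    omega
  -- For r ≥ 1 a step has length at most r, so the next ball of radius r lies in the doubled current
  -- ball. For r < 1 the balls are single vertices and a step is one edge. Since r ≤ 2k, 2N steps
  -- suffice.
  set k : ℕ := max 1 ⌊r⌋₊ with hk
  have hrk : r ≤ 2 * k := by
    have e1 := Nat.lt_floor_add_one r
    have e2 : ((⌊r⌋₊ + 1 : ℕ) : ℝ) ≤ ((2 * k : ℕ) : ℝ) := by exact_mod_cast (by omega)
    push_cast at e2
    linarith
  have key := chain_bound (P := fun i β => ∀ w, (W.graph.dist (γ i) w : ℝ) < r → β ≤ s w) (k := k)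
    (n := 2 * N) (L := W.graph.dist a b) hq0 ?_ ?_ hα (by rw [h0]; exact h)
  · rw [h1] at key; rw [← hq]; exact key
  · intro i j β hij hjk hjL hβ hi w hw
    rcases hij.eq_or_lt with rfl | hlt
    · exact (mul_le_of_le_one_left hβ hq1).trans (hi w hw)
    rcases lt_or_ge r 1 with hr1 | hr1
    · have : ⌊r⌋₊ = 0 := Nat.floor_eq_zero.2 hr1
      obtain rfl : j = i + 1 := by omega
      have : (W.graph.dist (γ (i + 1)) w : ℝ) < (1 : ℕ) := by push_cast; linarith
      have := Nat.cast_lt.1 this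
      obtain rfl := W.connected.dist_eq_zero_iff.1
        (show W.graph.dist (γ (i + 1)) w = 0 by omega)
      have hl := hs (γ (i + 1)) (hgeo _ hjL) (γ (i + 1)) (by simpa using hr)
      calc q * β ≤ p * s (γ i) := mul_le_mul hqp (hi _ (by simpa using hr)) hβ hp0.le
        _ ≤ s (γ (i + 1)) := hp.mul_le hl (fun z _ => hnn z) (hadj i (by omega)).symm
    · have hdij : (W.graph.dist (γ i) (γ j) : ℝ) ≤ r := by
        rw [hd i j hij hjL]
        have e1 : ((j - i : ℕ) : ℝ) ≤ ⌊r⌋₊ := by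
          have : 1 ≤ ⌊r⌋₊ := Nat.le_floor (by simpa using hr1)
          exact_mod_cast (by omega)
        exact e1.trans (Nat.floor_le hr.le)
      rw [hq]
      refine hg.superharmonic_double hp hD hr hβ hnn (hs (γ i) (hgeo i (by omega))) hi ?_
      linarith [W.dist_triangle_real (γ i) (γ j) w]
  · have : (W.graph.dist a b : ℝ) ≤ ((2 * N * k : ℕ) : ℝ) := by
      push_cast
      calc (W.graph.dist a b : ℝ) ≤ N * r := hN
        _ ≤ N * (2 * k) := mul_le_mul_of_nonneg_left hrk (Nat.cast_nonneg N)
        _ = 2 * N * k := by ring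
    exact_mod_cast this

theorem lap_add_potential (A : Finset V) (f : V → ℝ) {x : V} (hx : x ∈ A) :
    W.lap (fun y => f y + ∑ z ∈ A, W.gr A y z * W.lap f z) x = 0 := by
  rw [W.lap_add f (fun y => ∑ z ∈ A, W.gr A y z * W.lap f z), W.lap_potential _ hx]; ring

/-- The walk started at `y` leaves `B(y,2R)` through `B(z,t)` with probability bounded below. -/
theorem GreenBounds.exists_exit_function {p D C c : ℝ} (hp : W.Elliptic p) (hD : W.Doubling D)
    (hg : W.GreenBounds C c) {y z : V} {R t r : ℝ} {N : ℕ} (hr : 0 < r)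
    (h1 : 2 * R + r ≤ W.graph.dist z y) (h2 : W.graph.dist z y ≤ 2 * R + t - 8 * r)
    (h3 : W.graph.dist z y ≤ N * r) :
    ∃ ψ : V → ℝ, (∀ w, (W.graph.dist y w : ℝ) < 2 * R → W.lap ψ w = 0) ∧
      (∀ w, 2 * R ≤ W.graph.dist y w →
        ψ w = if (W.graph.dist z w : ℝ) < t then 1 else 0) ∧
      (c * p / (2 * C * D)) ^ (2 * N) ≤ ψ y := by
  set A := W.fball y (2 * R) with hA
  -- The function ψ is the harmonic extension of these boundary values. It equals 1 on B(z,r), and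
  -- the lower bound is propagated from z to y.
  obtain ⟨ψ₀, hψ₀⟩ : ∃ ψ₀ : V → ℝ, ψ₀ = fun w =>
    if (W.graph.dist z w : ℝ) < t ∧ 2 * R ≤ W.graph.dist y w then 1 else 0 := ⟨_, rfl⟩
  obtain ⟨ψ, hψ⟩ : ∃ ψ : V → ℝ, ψ = fun w => ψ₀ w + ∑ v ∈ A, W.gr A w v * W.lap ψ₀ v := ⟨_, rfl⟩
  have hlap : ∀ w ∈ A, W.lap ψ w = 0 := fun w hw => by rw [hψ]; exact lap_add_potential A ψ₀ hw
  have hout : ∀ w ∉ A, ψ w = ψ₀ w := fun w hw => by rw [hψ]; exact add_potential_eq A ψ₀ hw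
  have h01 : ∀ w, 0 ≤ ψ₀ w ∧ ψ₀ w ≤ 1 := fun w => by
    rw [hψ₀]; dsimp only; split_ifs <;> norm_num
  have hnn : ∀ w, 0 ≤ ψ w := fun w => by
    by_cases hw : w ∈ A
    · exact W.nonneg_of_lap_nonpos (A := A) (fun v hv => (hlap v hv).le)
        (fun _ _ v _ hv => by rw [hout v hv]; exact (h01 v).1) w hw
    · rw [hout w hw]; exact (h01 w).1
  have hle : ∀ w, ψ w ≤ 1 := fun w => by
    by_cases hw : w ∈ A
    · exact W.le_of_lap_le (A := A) (v := fun _ => 1)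
        (fun v hv => by rw [hlap v hv, lap_const])
        (fun _ _ v _ hv => by rw [hout v hv]; exact (h01 v).2) w hw
    · rw [hout w hw]; exact (h01 w).2
  have hone : ∀ w, (W.graph.dist z w : ℝ) < t → 2 * R ≤ W.graph.dist y w → ψ w = 1 :=
    fun w hw hw2 => by
      rw [hout w (by rw [hA, mem_fball]; exact not_lt.2 hw2), hψ₀]
      exact if_pos ⟨hw, hw2⟩
  refine ⟨ψ, fun w hw => hlap w (W.mem_fball.2 hw), fun w hw => ?_, ?_⟩
  · rw [hout w (by rw [hA, mem_fball]; exact not_lt.2 hw), hψ₀]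
    simp [hw]
  · have := hg.chain hp hD (a := z) (b := y) (N := N) (s := ψ) hr zero_le_one hnn h3 ?_ ?_ y
      (by simpa using hr)
    · simpa using this
    · intro v hv w hw
      rcases lt_or_ge (W.graph.dist y w : ℝ) (2 * R) with hyw | hyw
      · exact (hlap w (W.mem_fball.2 hyw)).le
      -- Off B(y,2R), a point within 4r of the geodesic has d(z,w) < t; this is what the margin 8r
      -- is for. There ψ attains its maximum 1, so it is superharmonic although not harmonic.
      · have hvr : (W.graph.dist z v : ℝ) + W.graph.dist v y = W.graph.dist z y := by
          exact_mod_cast hv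
        have t1 := W.dist_triangle_real y v w
        have t2 := W.dist_triangle_real z v w
        have t3 := W.dist_comm_real v y
        refine W.lap_nonpos_of_max fun v' _ => ?_
        rw [hone w (by linarith) hyw]
        exact hle v'
    · intro w hw
      have t1 := W.dist_triangle_real z w y
      have t2 := W.dist_comm_real w y
      rw [hone w (by linarith) (by linarith)]

/-- Comparison of the scales of the Green kernel at two distant points. -/
theorem GreenBounds.gscale_le_of_dist {p D C c : ℝ} (hp : W.Elliptic p) (hD : W.Doubling D)
    (hg : W.GreenBounds C c) {y z : V} {R t r : ℝ} {N : ℕ} (hR : 0 < R) (ht : 0 < t) (hr : 0 < r)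
    (h1 : 2 * R + r ≤ W.graph.dist z y) (h2 : W.graph.dist z y ≤ 2 * R + t - 8 * r)
    (h3 : W.graph.dist z y ≤ N * r) (h4 : 2 * t + 1 + R / 4 ≤ W.graph.dist z y) :
    W.gscale z t ≤ C * (2 * D) ^ 2 / (c * (c * p / (2 * C * D)) ^ (2 * N)) * W.gscale y R := by
  have hC0 : 0 < C := zero_lt_one.trans_le hg.one_le
  have hD0 : 0 < D := zero_lt_one.trans_le hD.one_le
  have hp0 := hp.pos
  have hc0 := hg.pos
  obtain ⟨Q, hQ⟩ : ∃ Q, Q = (c * p / (2 * C * D)) ^ (2 * N) := ⟨_, rfl⟩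
  have hQ0 : 0 < Q := by rw [hQ]; positivity
  rw [← hQ]
  obtain ⟨ψ, hψ1, hψ2, hψ3⟩ := hg.exists_exit_function hp hD hr h1 h2 h3
  rw [← hQ] at hψ3
  set A := W.fball y (2 * R) with hA
  have hFz := W.gscale_pos z ht
  have hFy := W.gscale_pos y hR
  set u := W.gb z (2 * t) with hu
  have hyA : y ∈ A := W.self_mem_fball y (by positivity)
  -- The right side is the value at y of the harmonic extension into A of the kernel u with pole z.
  -- By (g), u ≥ cF(z,t) on B(z,t), so on the boundary u dominates cF(z,t)ψ.
  have key : c * W.gscale z t * ψ y ≤ u y + ∑ v ∈ A, W.gr A y v * W.lap u v := by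
    refine W.le_of_lap_le (A := A) (u := fun w => c * W.gscale z t * ψ w)
      (v := fun w => u w + ∑ v ∈ A, W.gr A w v * W.lap u v) (fun w hw => ?_)
      (fun _ _ w _ hw => ?_) y hyA
    · rw [lap_add_potential A u hw, lap_const_mul, hψ1 w (W.mem_fball.1 hw), mul_zero]
    · rw [add_potential_eq A u hw, hψ2 w (not_lt.1 fun h => hw (W.mem_fball.2 h))]
      split_ifs with h
      · rw [mul_one]; exact hg.lower z t ht w h
      · rw [mul_zero]; exact W.gb_nonneg _ _ _
  obtain ⟨G, hG⟩ : ∃ G, G = C * (2 * D) ^ 2 * W.gscale y R := ⟨_, rfl⟩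
  have hG0 : 0 < G := by rw [hG]; positivity
  -- Positive contributions arise only off B(z,2t), at vertices receiving flux from it. The assumed
  -- separation puts them at distance at least R/4 from y, where the kernel of A with pole y is at
  -- most G; the total flux is at most one.
  have hterm : ∀ v ∈ A, W.gr A y v * W.lap u v
      ≤ G * (if v ∉ W.fball z (2 * t) then W.lap u v else 0) := by
    intro v hv
    by_cases hvB : v ∈ W.fball z (2 * t)
    · rw [if_neg (not_not.2 hvB), mul_zero]
      exact mul_nonpos_of_nonneg_of_nonpos (W.gr_nonneg _ _ _) (W.lap_gr_nonpos z hvB)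
    · rw [if_pos hvB]
      have hv0 : u v = 0 := W.gr_right_eq_zero z hvB
      rcases le_or_gt (R / 4) (W.graph.dist y v) with hvR | hvR
      · have hl : 0 ≤ W.lap u v := Finset.sum_nonneg fun w _ =>
          mul_nonneg (W.cond_nonneg v w) (by rw [hv0, sub_zero]; exact W.gb_nonneg _ _ _)
        refine mul_le_mul_of_nonneg_right ?_ hl
        have := hg.gb_le hD y (show 0 < R / 4 by positivity) 2 hvR
        rw [show 2 ^ 2 * (R / 4) = R by ring] at this
        rw [hG]; exact this
      · have hl : W.lap u v = 0 := by
          rw [W.lap_congr (v := fun _ => 0) hv0 fun w hw => ?_, lap_const]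
          refine W.gr_right_eq_zero z fun hwB => ?_
          rw [mem_fball] at hwB
          have t1 := W.dist_lt_of_adj_real (x := z) hw.symm
          have t2 := W.dist_triangle_real z v y
          have t3 := W.dist_comm_real v y
          linarith
        rw [hl]; simp
  have hsum : ∑ v ∈ A, W.gr A y v * W.lap u v ≤ G := by
    calc ∑ v ∈ A, W.gr A y v * W.lap u v
        ≤ ∑ v ∈ A, G * (if v ∉ W.fball z (2 * t) then W.lap u v else 0) := Finset.sum_le_sum hterm
      _ = G * ∑ v ∈ A.filter (fun v => v ∉ W.fball z (2 * t)), W.lap u v := by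
          rw [← Finset.mul_sum, Finset.sum_filter]
      _ ≤ G * 1 := mul_le_mul_of_nonneg_left (W.sum_lap_gr_le_one (Finset.disjoint_left.2
          fun v hv => (Finset.mem_filter.1 hv).2) z) hG0.le
      _ = G := mul_one G
  have huy : u y = 0 := W.gb_eq_zero (by linarith)
  rw [huy, zero_add] at key
  have hfin : c * W.gscale z t * Q ≤ G :=
    (mul_le_mul_of_nonneg_left hψ3 (by positivity)).trans (key.trans hsum)
  rw [div_mul_eq_mul_div, le_div_iff₀ (by positivity), ← hG]
  linarith

/-- Doubling of the scale of the Green kernel. -/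
theorem GreenBounds.exists_gscale_le {p D C c : ℝ} (hp : W.Elliptic p) (hD : W.Doubling D)
    (hg : W.GreenBounds C c) :
    ∃ K : ℝ, 0 < K ∧ ∀ (y : V) (r : ℝ), 160 ≤ r → W.gscale y (2 * r) ≤ K * W.gscale y (r / 8) := by
  have hC0 : 0 < C := zero_lt_one.trans_le hg.one_le
  have hD0 : 0 < D := zero_lt_one.trans_le hD.one_le
  have hp0 := hp.pos
  have hc0 := hg.pos
  obtain ⟨K, hK⟩ : ∃ K, K = C * (2 * D) ^ 2 / (c * (c * p / (2 * C * D)) ^ (2 * 320)) := ⟨_, rfl⟩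
  have hK0 : 0 < K := by rw [hK]; positivity
  have step : ∀ (y : V) (R : ℝ), 20 ≤ R →
      W.gscale y (13 / 10 * R) ≤ K * K * W.gscale y R := by
    intro y R hR
    -- The scale is enlarged by going to a point at distance about 3R and back: F(y,1.3R) ≲
    -- F(z,1.3R) ≲ F(y,R). The ratio 1.3 meets the overlap and separation conditions both ways, and
    -- R ≥ 20 absorbs the rounding.
    obtain ⟨z, hz⟩ := W.exists_dist_eq y ⌈3 * R⌉₊
    have e1 := Nat.le_ceil (3 * R)
    have e2 := Nat.ceil_lt_add_one (show 0 ≤ 3 * R by linarith)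
    rw [← hz] at e1 e2
    have e3 := W.dist_comm_real y z
    have k1 := hg.gscale_le_of_dist hp hD (y := y) (z := z) (R := R) (t := 13 / 10 * R)
      (r := R / 80) (N := 320) (by linarith) (by linarith) (by linarith) (by linarith)
      (by linarith) (by push_cast; linarith) (by linarith)
    have k2 := hg.gscale_le_of_dist hp hD (y := z) (z := y) (R := 13 / 10 * R) (t := 13 / 10 * R)
      (r := R / 80) (N := 320) (by linarith) (by linarith) (by linarith) (by linarith)
      (by linarith) (by push_cast; linarith) (by linarith)
    rw [← hK] at k1 k2
    calc _ ≤ K * W.gscale z (13 / 10 * R) := k2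
      _ ≤ K * (K * W.gscale y R) := mul_le_mul_of_nonneg_left k1 hK0.le
      _ = K * K * W.gscale y R := by ring
  have iter : ∀ (y : V) (R : ℝ), 20 ≤ R → ∀ n : ℕ,
      W.gscale y ((13 / 10) ^ n * R) ≤ (K * K) ^ n * W.gscale y R := by
    intro y R hR n
    induction n with
    | zero => simp
    | succ n ih =>
      have h1 : (1 : ℝ) ≤ (13 / 10) ^ n := one_le_pow₀ (by norm_num)
      have h2 := step y ((13 / 10) ^ n * R) (by nlinarith)
      calc W.gscale y ((13 / 10) ^ (n + 1) * R) = W.gscale y (13 / 10 * ((13 / 10) ^ n * R)) := by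
            congr 1; ring
        _ ≤ K * K * ((K * K) ^ n * W.gscale y R) :=
            h2.trans (mul_le_mul_of_nonneg_left ih (by positivity))
        _ = (K * K) ^ (n + 1) * W.gscale y R := by ring
  refine ⟨D * (K * K) ^ 11, by positivity, fun y r hr => ?_⟩
  -- The power 1.3¹¹ ≈ 17.9 carries r/8 to a radius between 2r and 4r, from which
  -- `Doubling.gscale_le` returns to 2r at the cost of D.
  have h1 := iter y (r / 8) (by linarith) 11
  have h2 := hD.gscale_le y (r := 2 * r) (s := (13 / 10) ^ 11 * (r / 8)) (by linarith)
    (by norm_num; linarith) (by norm_num; linarith)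
  calc _ ≤ _ := h2
    _ ≤ D * ((K * K) ^ 11 * W.gscale y (r / 8)) := mul_le_mul_of_nonneg_left h1 hD0.le
    _ = _ := by ring

end

end WeightedGraph

/-! ### Comparison of Green kernels with different poles, and the elliptic Harnack inequality. -/

namespace WeightedGraph

noncomputable section

open scoped Classical

variable {V : Type*} {W : WeightedGraph V}

/-- A bound along a geodesic inside a ball, from the centre to any point and back. -/
theorem le_mul_of_steps {x y z : V} {R q : ℝ} {k n : ℕ} {u : V → ℝ} (hq0 : 0 < q) (hq1 : q ≤ 1)
    (hnk : R ≤ n * k) (hnn : ∀ w, (W.graph.dist x w : ℝ) < R → 0 ≤ u w)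
    (step : ∀ a b, (W.graph.dist x a : ℝ) < R → (W.graph.dist x b : ℝ) < R →
      0 < W.graph.dist a b → W.graph.dist a b ≤ k → q * u a ≤ u b)
    (hy : (W.graph.dist x y : ℝ) < R) (hz : (W.graph.dist x z : ℝ) < R) :
    u y ≤ (q⁻¹) ^ (2 * n) * u z := by
  have key : ∀ a b, W.graph.dist a b ≤ n * k → (∀ v, W.graph.dist a v + W.graph.dist v b
      = W.graph.dist a b → (W.graph.dist x v : ℝ) < R) → q ^ n * u a ≤ u b := by
    intro a b hab hgeo
    obtain ⟨γ, h0, h1, hadj, hd⟩ := W.exists_geodesic a b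
    have hγ : ∀ j ≤ W.graph.dist a b, (W.graph.dist x (γ j) : ℝ) < R := by
      intro j hj
      have e1 := hd 0 j (Nat.zero_le _) hj
      have e2 := hd j _ hj le_rfl
      rw [h0] at e1
      rw [h1] at e2
      exact hgeo _ (by omega)
    have hua := hnn _ (hγ 0 (Nat.zero_le _))
    have hch := chain_bound (P := fun i α => α ≤ u (γ i)) (k := k) (n := n)
      (L := W.graph.dist a b) (α := u a) hq0.le ?_ hab (by rwa [h0] at hua) (by rw [h0])
    · rwa [h1] at hch
    · intro i j α hij hjk hjL hα hi
      rcases hij.eq_or_lt with rfl | hlt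
      · exact (mul_le_of_le_one_left hα hq1).trans hi
      · have e := hd i j hij hjL
        exact (mul_le_mul_of_nonneg_left hi hq0.le).trans
          (step _ _ (hγ i (by omega)) (hγ j hjL) (by omega) (by omega))
  have hbound : ∀ w, (W.graph.dist x w : ℝ) < R → W.graph.dist x w ≤ n * k := fun w hw => by
    have : (W.graph.dist x w : ℝ) ≤ ((n * k : ℕ) : ℝ) := by push_cast; linarith
    exact_mod_cast this
  have k1 := key y x (by rw [SimpleGraph.dist_comm]; exact hbound y hy) fun v hv => by
    have hvr : (W.graph.dist y v : ℝ) + W.graph.dist v x = W.graph.dist y x := by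
      exact_mod_cast hv
    have := W.dist_comm_real x v
    have := W.dist_comm_real x y
    have : (0 : ℝ) ≤ W.graph.dist y v := Nat.cast_nonneg _
    linarith
  have k2 := key x z (hbound z hz) fun v hv => by
    have hvr : (W.graph.dist x v : ℝ) + W.graph.dist v z = W.graph.dist x z := by
      exact_mod_cast hv
    have : (0 : ℝ) ≤ W.graph.dist v z := Nat.cast_nonneg _
    linarith
  have hqn : 0 < q ^ n := pow_pos hq0 n
  have k3 : q ^ (2 * n) * u y ≤ u z := by
    calc q ^ (2 * n) * u y = q ^ n * (q ^ n * u y) := by ring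
      _ ≤ q ^ n * u x := mul_le_mul_of_nonneg_left k1 hqn.le
      _ ≤ u z := k2
  rw [inv_pow, inv_mul_eq_div, le_div_iff₀ (pow_pos hq0 _)]
  linarith

variable [W.LocFinite] [Infinite V]

/-- The Green kernel of a ball with poles near the centre, evaluated away from the centre. -/
theorem GreenBounds.exists_gr_le {p D C c : ℝ} (hp : W.Elliptic p) (hD : W.Doubling D)
    (hg : W.GreenBounds C c) :
    ∃ K : ℝ, 0 < K ∧ ∀ (x a b z : V) (r : ℝ), 160 ≤ r → (W.graph.dist x a : ℝ) < r / 2 →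
      (W.graph.dist x b : ℝ) < r / 2 → r ≤ W.graph.dist x z →
      W.gr (W.fball x (2 * r)) a z ≤ K * W.gr (W.fball x (2 * r)) b z := by
  obtain ⟨K, hK0, hK⟩ := hg.exists_gscale_le hp hD
  have hC0 : 0 < C := zero_lt_one.trans_le hg.one_le
  have hD0 : 0 < D := zero_lt_one.trans_le hD.one_le
  have hp0 := hp.pos
  have hc0 := hg.pos
  obtain ⟨q, hq⟩ : ∃ q, q = c * p / (2 * C * D) := ⟨_, rfl⟩
  have hq0 : 0 < q := by rw [hq]; positivity
  obtain ⟨K', hK'⟩ : ∃ K', K' = C * (2 * D) ^ 2 * K / (q ^ 32 * c) := ⟨_, rfl⟩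
  have hK'0 : 0 < K' := by rw [hK']; positivity
  refine ⟨K', hK'0, fun x a b z r hr ha hb hz => ?_⟩
  have hr0 : 0 < r := by linarith
  set U := W.fball x (2 * r) with hU
  -- With the pole moved to z by symmetry, g(z,a) is at most a multiple of F(z,2r), hence of
  -- F(z,r/8). The lower bound cF(z,r/8) near z propagates to x in 12 lengths r/8, and from x to b
  -- in 4 more.
  have ring_le : ∀ z, r ≤ W.graph.dist x z → (W.graph.dist x z : ℝ) ≤ 3 / 2 * r →
      W.gr U a z ≤ K' * W.gr U b z := by
    intro z hz1 hz2
    have tz := W.dist_comm_real z x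
    have hF := W.gscale_pos z (show 0 < r / 8 by positivity)
    have up : W.gr U a z ≤ C * (2 * D) ^ 2 * (K * W.gscale z (r / 8)) := by
      have t1 := W.dist_triangle_real x a z
      have t2 := W.dist_comm_real a z
      have h1 := hg.gb_le hD z (show 0 < r / 2 by positivity) 2 (w := a) (by linarith)
      rw [show 2 ^ 2 * (r / 2) = 2 * r by ring] at h1
      have h2 : W.gr U z a ≤ W.gb z (2 * (2 * r)) a :=
        W.gr_mono (W.fball_subset (by linarith)) z a
      rw [W.gr_symm U a z]
      exact h2.trans (h1.trans (mul_le_mul_of_nonneg_left (hK z r hr) (by positivity)))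
    have near : ∀ v, (W.graph.dist x v : ℝ) ≤ 3 / 2 * r →
        ∀ w, (W.graph.dist v w : ℝ) < 4 * (r / 8) → W.lap (W.gr U z) w ≤ 0 := by
      intro v hv w hw
      refine W.lap_gr_nonpos z ?_
      rw [hU, mem_fball]
      linarith [W.dist_triangle_real x v w]
    have low0 : ∀ w, (W.graph.dist z w : ℝ) < r / 8 → c * W.gscale z (r / 8) ≤ W.gr U z w := by
      intro w hw
      have h1 := hg.lower z (r / 8) (by positivity) w hw
      exact h1.trans (W.gr_mono (W.fball_subset (by linarith)) z w)
    have low1 := hg.chain hp hD (a := z) (b := x) (N := 12) (show 0 < r / 8 by positivity)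
      (by positivity) (fun w => W.gr_nonneg U z w) (by push_cast; linarith)
      (fun v hv => near v (by
        have hvr : (W.graph.dist z v : ℝ) + W.graph.dist v x = W.graph.dist z x := by
          exact_mod_cast hv
        have := W.dist_comm_real x v
        have : (0 : ℝ) ≤ W.graph.dist z v := Nat.cast_nonneg _
        linarith)) low0
    have low2 := hg.chain hp hD (a := x) (b := b) (N := 4) (show 0 < r / 8 by positivity)
      (by positivity) (fun w => W.gr_nonneg U z w) (by push_cast; linarith)
      (fun v hv => near v (by
        have hvr : (W.graph.dist x v : ℝ) + W.graph.dist v b = W.graph.dist x b := by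
          exact_mod_cast hv
        have : (0 : ℝ) ≤ W.graph.dist v b := Nat.cast_nonneg _
        linarith)) low1 b (by simpa using hr0)
    rw [← hq] at low2
    rw [W.gr_symm U b z]
    calc W.gr U a z ≤ C * (2 * D) ^ 2 * (K * W.gscale z (r / 8)) := up
      _ = K' * (q ^ (2 * 4) * (q ^ (2 * 12) * (c * W.gscale z (r / 8)))) := by
          rw [hK']; field_simp; ring
      _ ≤ K' * W.gr U z b := mul_le_mul_of_nonneg_left low2 hK'0.le
  rcases le_or_gt (W.graph.dist x z : ℝ) (3 / 2 * r) with h | h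
  · exact ring_le z hz h
  by_cases hzU : z ∈ U
  swap
  · rw [W.gr_right_eq_zero a hzU, W.gr_right_eq_zero b hzU, mul_zero]
  -- Beyond 3r/2 both kernels are harmonic and vanish off U, so the comparison is inherited from the
  -- ring.
  refine W.le_of_lap_le (A := U.filter fun z => 3 / 2 * r < W.graph.dist x z)
    (u := W.gr U a) (v := fun w => K' * W.gr U b w) (fun w hw => ?_) (fun w hw v hwv hv => ?_) z
    (Finset.mem_filter.2 ⟨hzU, h⟩)
  · rw [Finset.mem_filter] at hw
    rw [lap_const_mul, W.lap_gr_of_ne hw.1, W.lap_gr_of_ne hw.1, mul_zero]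
    · rintro rfl; linarith
    · rintro rfl; linarith
  · rw [Finset.mem_filter] at hw hv
    by_cases hvU : v ∈ U
    · have h1 := W.dist_lt_of_adj_real (x := x) hwv.symm
      exact ring_le v (by linarith) (not_lt.1 fun hc => hv ⟨hvU, hc⟩)
    · rw [W.gr_right_eq_zero a hvU, W.gr_right_eq_zero b hvU, mul_zero]

/-- The Harnack inequality on balls of large radius, for a small ratio of the radii. -/
theorem GreenBounds.exists_weak_harnack {p D C c : ℝ} (hp : W.Elliptic p) (hD : W.Doubling D)
    (hg : W.GreenBounds C c) :
    ∃ K : ℝ, 0 < K ∧ ∀ (x a b : V) (r : ℝ) (u : V → ℝ), 160 ≤ r →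
      (W.graph.dist x a : ℝ) < r / 2 → (W.graph.dist x b : ℝ) < r / 2 →
      (∀ z, (W.graph.dist x z : ℝ) < 2 * r → W.lap u z = 0) →
      (∀ z, (W.graph.dist x z : ℝ) < 2 * r → ∀ w, W.graph.Adj z w → 0 ≤ u w) →
      u a ≤ K * u b := by
  obtain ⟨K, hK0, hK⟩ := hg.exists_gr_le hp hD
  refine ⟨K, hK0, fun x a b r u hr ha hb hu hnn => ?_⟩
  set U := W.fball x (2 * r) with hU
  -- Cutting u off outside U lowers it there, so f is superharmonic in U. Its charge vanishes on
  -- B(x,r), where neighbours stay in U. Thus f is the Green potential of positive charges at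
  -- distance at least r from x.
  obtain ⟨f, hf⟩ : ∃ f : V → ℝ, f = fun z => if z ∈ U then u z else 0 := ⟨_, rfl⟩
  have hin : ∀ z ∈ U, f z = u z := fun z hz => by rw [hf]; exact if_pos hz
  have hout : ∀ z ∉ U, f z = 0 := fun z hz => by rw [hf]; exact if_neg hz
  have hle : ∀ z ∈ U, W.lap f z ≤ 0 := fun z hz => by
    rw [← hu z (W.mem_fball.1 hz)]
    refine W.lap_le_of_le (hin z hz) fun w hw => ?_
    by_cases hwU : w ∈ U
    · exact (hin w hwU).le
    · rw [hout w hwU]; exact hnn z (W.mem_fball.1 hz) w hw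
  have hzero : ∀ z, (W.graph.dist x z : ℝ) < r → W.lap f z = 0 := fun z hz => by
    rw [← hu z (by linarith)]
    refine W.lap_congr (hin z (W.mem_fball.2 (by linarith))) fun w hw => hin w (W.mem_fball.2 ?_)
    linarith [W.dist_lt_of_adj_real (x := x) hw]
  have haU : a ∈ U := W.mem_fball.2 (by linarith)
  have hbU : b ∈ U := W.mem_fball.2 (by linarith)
  have h1 := W.sum_gr_mul_lap hout haU
  have h2 := W.sum_gr_mul_lap hout hbU
  rw [hin a haU] at h1
  rw [hin b hbU] at h2
  have h3 : ∑ z ∈ U, K * (W.gr U b z * W.lap f z) ≤ ∑ z ∈ U, W.gr U a z * W.lap f z := by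
    refine Finset.sum_le_sum fun z hz => ?_
    rcases lt_or_ge (W.graph.dist x z : ℝ) r with hzr | hzr
    · rw [hzero z hzr]; simp
    · rw [← mul_assoc]
      exact mul_le_mul_of_nonpos_right (hK x a b z r hr ha hb hzr) (hle z hz)
  rw [← Finset.mul_sum, h1, h2] at h3
  linarith

theorem GreenBounds.ellipticHarnack {p D C c : ℝ} (hp : W.Elliptic p) (hD : W.Doubling D)
    (hg : W.GreenBounds C c) : W.EllipticHarnack := by
  obtain ⟨K, hK0, hK⟩ := hg.exists_weak_harnack hp hD
  have hp0 := hp.pos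
  obtain ⟨q, hq⟩ : ∃ q, q = (max K 1)⁻¹ := ⟨_, rfl⟩
  have hmax : 0 < max K 1 := lt_max_of_lt_right one_pos
  have hq0 : 0 < q := by rw [hq]; positivity
  have hq1 : q ≤ 1 := by rw [hq]; exact inv_le_one_of_one_le₀ (le_max_right _ _)
  refine ⟨1 + (p⁻¹) ^ (2 * 320) + (q⁻¹) ^ (2 * 8), ?_, fun x R hR u hu hnn y hy z hz => ?_⟩
  · have h1 : 0 < (p⁻¹) ^ (2 * 320) := by positivity
    have h2 : 0 < (q⁻¹) ^ (2 * 8) := by positivity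
    linarith
  have hu' : ∀ w, (W.graph.dist x w : ℝ) < 2 * R → W.lap u w = 0 :=
    fun w hw => (W.harmonicOn_iff.1 hu) w hw
  have hnn1 : ∀ w, (W.graph.dist x w : ℝ) < 2 * R → 0 ≤ u w := fun w hw => hnn w (Or.inl hw)
  have hnn2 : ∀ w, (W.graph.dist x w : ℝ) < 2 * R → ∀ v, W.graph.Adj w v → 0 ≤ u v :=
    fun w hw v hv => hnn v (Or.inr ⟨w, hw, hv⟩)
  have hz0 : 0 ≤ u z := hnn1 z (by have : (W.graph.dist x z : ℝ) < R := hz; linarith)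
  have hnnR : ∀ w, (W.graph.dist x w : ℝ) < R → 0 ≤ u w := fun w hw => hnn1 w (by linarith)
  have hP : 0 ≤ (p⁻¹) ^ (2 * 320) * u z := by positivity
  have hQ : 0 ≤ (q⁻¹) ^ (2 * 8) * u z := by positivity
  -- The weak Harnack inequality is applied on balls of radius parameter R/2, which must be at least
  -- 160. For smaller R at most 320 edges lead from y to x, and as many from x to z, each losing p.
  rcases lt_or_ge R 320 with hR2 | hR2
  · have := le_mul_of_steps (k := 1) (n := 320) hp0 hp.le_one (by push_cast; linarith) hnnR
      (fun a b ha hb h0 h1 => ?_) hy hz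
    · linarith
    · have hadj : W.graph.Adj a b := SimpleGraph.dist_eq_one_iff_adj.1 (by omega)
      exact hp.mul_le (hu' b (by linarith)).le (hnn2 b (by linarith)) hadj.symm
  · have hk1 : 1 < ⌈R / 4⌉₊ := Nat.lt_ceil.2 (by push_cast; linarith)
    have hk2 := Nat.le_ceil (R / 4)
    -- Steps of this many edges are shorter than R/4, half of R/2. Eight of them cover at least 2R -
    -- 8, which exceeds R.
    have := le_mul_of_steps (k := ⌈R / 4⌉₊ - 1) (n := 8) hq0 hq1
      (by
        have : ((⌈R / 4⌉₊ - 1 : ℕ) : ℝ) = ⌈R / 4⌉₊ - 1 := by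
          rw [Nat.cast_sub hk1.le, Nat.cast_one]
        rw [this]; push_cast; linarith) hnnR
      (fun a b ha hb h0 h1 => ?_) hy hz
    · linarith
    · have hab : (W.graph.dist a b : ℝ) < R / 4 := Nat.lt_ceil.1 (by omega)
      have hin : ∀ w, (W.graph.dist a w : ℝ) < 2 * (R / 2) → (W.graph.dist x w : ℝ) < 2 * R :=
        fun w hw => by linarith [W.dist_triangle_real x a w]
      have h := hK a a b (R / 2) u (by linarith) (by simp; linarith) (by linarith)
        (fun w hw => hu' w (hin w hw)) (fun w hw => hnn2 w (hin w hw))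
      have h2 : u a ≤ max K 1 * u b :=
        h.trans (mul_le_mul_of_nonneg_right (le_max_left _ _) (hnnR b hb))
      rw [hq, inv_mul_eq_div, div_le_iff₀ hmax]
      linarith

end

end WeightedGraph

theorem mainTheorem5 {V : Type*} [Infinite V] [Countable V]
    [MeasurableSpace V] [DiscreteMeasurableSpace V] (W : WeightedGraph V)
    (hp₀ : W.ControlledWeights) (hVD : W.VolumeDoubling) :
    W.GreenKernelBounds ↔ W.EllipticHarnack ∧ W.EinsteinRelation := by
  obtain ⟨p, hp⟩ := hp₀.exists_elliptic
  have := hp.locFinite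
  obtain ⟨D, hD⟩ := hVD.exists_doubling
  constructor
  · intro h
    obtain ⟨C, c, hg⟩ := h.exists_greenBounds
    exact ⟨hg.ellipticHarnack hp hD, hg.einsteinRelation hp hD⟩
  · rintro ⟨hH, hE⟩
    exact WeightedGraph.greenKernelBounds_of_harnack_of_einstein hp hD hH hE
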